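/- Let $U_\infty=\bigcup_n U_n$ be the direct limit of the unitary groups $U_n$ under the inclusions $u\mapsto u\oplus 1$, with the operator norm, and let $\Gamma=\langle a,b,c\mid aca^{-1}c^{-1},\,b^2,\,(ab)^2\rangle$. For unitaries $\sigma=(\sigma(a),\sigma(b),\sigma(c))$ in $U_\infty$ let the deviation $|||\sigma|||$ be the maximum of $\|r(\sigma(a),\sigma(b),\sigma(c))-I\|$ over the three relators $r$. An asymptotic representation of $\Gamma$ is a triple of norm-continuous paths $\sigma_t=(\sigma_t(a),\sigma_t(b),\sigma_t(c))$, $t\in[0,\infty)$, in $U_\infty$ with $|||\sigma_t|||\to 0$ as $t\to\infty$. Two asymptotic representations $\sigma_t$ and $\rho_t$ are homotopic (in the class of asymptotic representations) if there is a family $\sigma^s_t$, $(s,t)\in[0,1]\times[0,\infty)$, jointly norm-continuous in $(s,t)$, with $\sigma^0_t=\sigma_t$, $\sigma^1_t=\rho_t$ and $\sup_{s}|||\sigma^s_t|||\to 0$ as $t\to\infty$. For $u,v\in U_n$ with $\|uv-vu\|<2$, the winding number of the pair $(u,v)$ is the winding number around $0$ of the closed path $r\mapsto\det((1-r)uv+r\,vu)$,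 $r\in[0,1]$, in $\mathbb C\setminus\{0\}$; it does not depend on the choice of $n$ with $u,v\in U_n$. Let $\sigma_t$ be an asymptotic representation of $\Gamma$. Then for all sufficiently large $t$ one has $\|\sigma_t(a)\sigma_t(c)-\sigma_t(c)\sigma_t(a)\|<2$, and the winding number of the pair $(\sigma_t(a),\sigma_t(c))$ is zero. Moreover, $\sigma_t$ is homotopic, in the class of asymptotic representations, to an asymptotic representation $\rho_t$ of $\Gamma$ with $\rho_t(c)=I$ for all $t\in[0,\infty)$. -/

import Mathlib

open scoped NNReal Topology lp
open Filter

namespace AsymRep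

/-! ### The group `U_∞` -/

/-- The Hilbert space `ℓ²(ℕ)`, on which all the groups `U_n` act. -/
abbrev Hil : Type := ℓ²(ℕ, ℂ)

/-- The standard basis vector `e_k` of `ℓ²(ℕ)`. -/
noncomputable def basisVec (k : ℕ) : Hil := lp.single 2 k (1 : ℂ)

/-- The group `U_n`, embedded in the unitary group of `ℓ²(ℕ)` by `u ↦ u ⊕ 1`: the unitaries that
fix `e_k` for all `k ≥ n`. (Such a unitary preserves the span of `e_0, …, e_{n-1}`.) -/
def levelU (n : ℕ) : Subgroup (unitary (Hil →L[ℂ] Hil)) where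
  carrier := {u | ∀ k, n ≤ k → (u : Hil →L[ℂ] Hil) (basisVec k) = basisVec k}
  one_mem' := fun _ _ => rfl
  mul_mem' := by
    intro u v hu hv k hk
    change (u : Hil →L[ℂ] Hil) ((v : Hil →L[ℂ] Hil) (basisVec k)) = basisVec k
    rw [hv k hk, hu k hk]
  inv_mem' := by
    intro u hu k hk
    have h : ((u⁻¹ * u : unitary (Hil →L[ℂ] Hil)) : Hil →L[ℂ] Hil) (basisVec k) = basisVec k := by
      rw [inv_mul_cancel]; rfl
    change ((u⁻¹ : unitary (Hil →L[ℂ] Hil)) : Hil →L[ℂ] Hil)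
      ((u : Hil →L[ℂ] Hil) (basisVec k)) = basisVec k at h
    rwa [hu k hk] at h

theorem levelU_mono {m n : ℕ} (h : m ≤ n) : levelU m ≤ levelU n :=
  fun _ hu k hk => hu k (h.trans hk)

/-- `U_∞ = ⋃ U_n`, with the operator norm of `ℓ²(ℕ)` (and the topology which that norm induces). -/
def UInf : Subgroup (unitary (Hil →L[ℂ] Hil)) where
  carrier := {u | ∃ n, u ∈ levelU n}
  one_mem' := ⟨0, (levelU 0).one_mem⟩
  mul_mem' := by
    rintro u v ⟨m, hu⟩ ⟨n, hv⟩
    exact ⟨max m n, (levelU _).mul_mem (levelU_mono (le_max_left m n) hu)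
      (levelU_mono (le_max_right m n) hv)⟩
  inv_mem' := by
    rintro u ⟨n, hu⟩
    exact ⟨n, (levelU n).inv_mem hu⟩

/-- The operator on `ℓ²(ℕ)` underlying an element of `U_∞`. -/
noncomputable def opU (u : UInf) : Hil →L[ℂ] Hil := ((u : unitary (Hil →L[ℂ] Hil)) : Hil →L[ℂ] Hil)

/-- The `n × n` matrix in the upper left corner of an operator. -/
noncomputable def corner (n : ℕ) (x : Hil →L[ℂ] Hil) : Matrix (Fin n) (Fin n) ℂ :=
  Matrix.of fun i j => x (basisVec j) (i : ℕ)

/-! ### Asymptotic representations of a finite presentation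

A presentation is given by a type `ι` of generators and a finite family `rel : κ → FreeGroup ι` of
relators. -/

section Presentation

variable {ι κ : Type*}

/-- The deviation `max_j ‖r_j(u_1, …, u_n) - I‖` of a family of unitaries `u : ι → U_∞`. -/
noncomputable def deviation [Finite κ] (rel : κ → FreeGroup ι) (u : ι → UInf) : ℝ :=
  ⨆ j, ‖opU (FreeGroup.lift u (rel j)) - 1‖

/-- Asymptotic representations: norm-continuous paths `σ_t`, `t ∈ [0, ∞)`, in `U_∞`, one for each
generator, with deviation tending to zero. -/
structure IsAsymptoticRep [Finite κ] (rel : κ → FreeGroup ι) (σ : ℝ≥0 → ι → UInf) : Prop where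
  continuous_path : ∀ i, Continuous fun t => σ t i
  tendsto_deviation : Tendsto (fun t => deviation rel (σ t)) atTop (𝓝 0)

/-- Homotopy in the class of asymptotic representations: a norm-continuous family `F s t`,
`(s, t) ∈ [0, 1] × [0, ∞)`, of asymptotic representations whose deviation tends to zero as
`t → ∞`, uniformly in `s`. (Without uniformity the relation would be trivial.) -/
def AsymHomotopic [Finite κ] (rel : κ → FreeGroup ι) (σ ρ : ℝ≥0 → ι → UInf) : Prop :=
  ∃ F : unitInterval → ℝ≥0 → ι → UInf,
    (∀ i, Continuous fun p : unitInterval × ℝ≥0 => F p.1 p.2 i) ∧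
    (∀ s, IsAsymptoticRep rel (F s)) ∧
    TendstoUniformly (fun t s => deviation rel (F s t)) (fun _ => 0) atTop ∧
    F 0 = σ ∧ F 1 = ρ

end Presentation

/-! ### The winding number of a pair of almost commuting unitaries -/

/-- `w` is the winding number around `0` of the closed path `γ : [0, 1] → ℂ \ {0}`: some continuous
logarithm of `γ` increases by `2πi w` along the path. -/
def IsWindingNumber (γ : unitInterval → ℂ) (w : ℤ) : Prop :=
  ∃ L : unitInterval → ℂ, Continuous L ∧ (∀ r, Complex.exp (L r) = γ r) ∧
    L 1 - L 0 = 2 * Real.pi * Complex.I * w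

/-- `w` is the winding number of the pair `(u, v)`: one has `‖uv - vu‖ < 2`, and `w` is the winding
number around `0` of the closed path `r ↦ det ((1 - r) uv + r vu)`, the determinant being taken in
some `U_n` that contains `u` and `v` (it does not depend on `n`, since `(1 - r) uv + r vu` is the
identity on the remaining basis vectors). -/
def HasPairWindingNumber (u v : UInf) (w : ℤ) : Prop :=
  ‖opU u * opU v - opU v * opU u‖ < 2 ∧
  ∃ n : ℕ, (u : unitary (Hil →L[ℂ] Hil)) ∈ levelU n ∧ (v : unitary (Hil →L[ℂ] Hil)) ∈ levelU n ∧
    IsWindingNumber (fun r => (corner n ((1 - ((r : ℝ) : ℂ)) • (opU u * opU v) +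
      ((r : ℝ) : ℂ) • (opU v * opU u))).det) w

/-! ### The group `Γ = ⟨a, b, c | a c a⁻¹ c⁻¹, b², (ab)²⟩` -/

/-- The generators of `Γ`. -/
inductive Gen : Type
  | a : Gen
  | b : Gen
  | c : Gen

/-- The relators `a c a⁻¹ c⁻¹`, `b²`, `(ab)²` of `Γ`. -/
def relΓ : Fin 3 → FreeGroup Gen :=
  ![FreeGroup.of Gen.a * FreeGroup.of Gen.c * (FreeGroup.of Gen.a)⁻¹ * (FreeGroup.of Gen.c)⁻¹,
    FreeGroup.of Gen.b ^ 2,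
    (FreeGroup.of Gen.a * FreeGroup.of Gen.b) ^ 2]

end AsymRep

/-! The relations of `Γ` say that `b` and `ab` are involutions, so that `b` inverts `a`, and that
`c` commutes with `a`; nothing relates `b` and `c`. Along an asymptotic representation, `b` and `ab`
are almost involutions, hence close to exact ones (`exists_involution`). Close involutions are
conjugate, so the finite rank of `v - 1` is constant along the path (`exists_rank_bound`). Thus for
large `t` the operator `σ_t(a)` is close to a product of two involutions, and this product minus `1`
has rank bounded independently of `t`.

A rank bound limits the number of eigenvalues. A function `h` on the circle, taken from a finite
family, close to the identity and symmetric under conjugation, then sends all eigenvalues to `m`-th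
roots of unity with `m` independent of `t` (`exists_collapse`). Once `a ^ m = 1`, averaging `a ^ k c
a ^ (-k)` over `k < m` and taking the unitary polar part makes `c` commute with `a` exactly, at a
cost controlled by `m` (`exists_intertwiner`). So `σ_t` is close to an exact representation of
bounded rank (`exists_exactRep_near`). By the same device, two close exact representations of
bounded rank are joined by a short path of exact ones (`exactReps_locally_joined`).

Consequently `σ_t` is asymptotic, up to a shift of the parameter, to a path of exact representations
(`exists_asymptotic_path`). Such a path is homotopic to a constant one by rescaling time, and there
`c` contracts to `1` inside the commutant of `a` (`joinedIn_exactReps_one`). For the winding number,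
the pair `(σ_t(a), σ_t(c))` is close to an exactly commuting pair, whose loop of determinants is
constant (`hasPairWindingNumber_zero`). -/

namespace AsymRep

/-! ### The Cayley path from the identity to a unitary -/

section Cayley

variable {A : Type*} [CStarAlgebra A]

/-- The denominator of the Cayley path. -/
noncomputable def cayDen (s : ℝ) (w : A) : A := ((1 + s : ℝ) : ℂ) • (1 : A) + ((1 - s : ℝ) : ℂ) • w

/-- The numerator of the Cayley path. -/
noncomputable def cayNum (s : ℝ) (w : A) : A := ((1 - s : ℝ) : ℂ) • (1 : A) + ((1 + s : ℝ) : ℂ) • w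

/-- The Cayley path `s ↦ ((1 - s) + (1 + s) w) ((1 + s) + (1 - s) w)⁻¹` from `1` to `w`. -/
noncomputable def cay (s : ℝ) (w : A) : A := cayNum s w * Ring.inverse (cayDen s w)

theorem isUnit_of_norm_sub_unitary_lt {x u : A} (hu : u ∈ unitary A) (h : ‖x - u‖ < 1) :
    IsUnit x := by
  have h1 : ‖1 - star u * x‖ < 1 := by
    have : 1 - star u * x = star u * (u - x) := by
      rw [mul_sub, Unitary.star_mul_self_of_mem hu]
    rw [this, CStarRing.norm_mem_unitary_mul _ (Unitary.star_mem hu), norm_sub_rev]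
    exact h
  have h2 : IsUnit (star u * x) := by
    have := isUnit_one_sub_of_norm_lt_one h1
    simpa using this
  have h3 : x = u * (star u * x) := by
    rw [← mul_assoc, Unitary.mul_star_self_of_mem hu, one_mul]
  rw [h3]
  exact (Unitary.toUnits (⟨u, hu⟩ : unitary A)).isUnit.mul h2

theorem ringInverse_eq_of_mul_eq_one {x y : A} (h : x * y = 1) (h' : y * x = 1) :
    Ring.inverse x = y :=
  Ring.inverse_unit (⟨x, y, h, h'⟩ : Aˣ)

theorem commute_ringInverse {x y : A} (h : Commute x y) : Commute x (Ring.inverse y) := by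
  by_cases hy : IsUnit y
  · obtain ⟨v, rfl⟩ := hy
    rw [Ring.inverse_unit]
    exact h.units_inv_right
  · rw [Ring.inverse_non_unit _ hy]
    exact Commute.zero_right x

theorem cayDen_eq (s : ℝ) (w : A) : cayDen s w = (2 : ℂ) • (1 : A) + ((1 - s : ℝ) : ℂ) • (w - 1) := by
  simp only [cayDen]; push_cast; module

/-- Divided by `2`, the denominator is `1` plus a term of norm at most `‖w - 1‖ / 2 < 1`. -/
theorem isUnit_cayDen {s : ℝ} (hs : s ∈ Set.Icc (0 : ℝ) 1) {w : A} (hw : ‖w - 1‖ < 2) :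
    IsUnit (cayDen s w) := by
  have h1 : cayDen s w = (2 : ℂ) • ((1 : A) + ((1 - s) / 2 : ℝ) • (w - 1)) := by
    rw [cayDen_eq, smul_add, ← Complex.coe_smul, smul_smul]; congr 2; push_cast; ring
  rw [h1]
  have h2 : IsUnit ((1 : A) + ((1 - s) / 2 : ℝ) • (w - 1)) := by
    apply isUnit_of_norm_sub_unitary_lt (one_mem (unitary A))
    rw [add_sub_cancel_left, norm_smul, Real.norm_of_nonneg (by linarith [hs.2])]
    nlinarith [hs.1, hs.2, norm_nonneg (w - 1)]
  exact h2.smul (Units.mk0 (2 : ℂ) two_ne_zero)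

theorem commute_cayDen {x w : A} (h : Commute x w) (s : ℝ) : Commute x (cayDen s w) :=
  ((Commute.one_right x).smul_right _).add_right (h.smul_right _)

theorem commute_cayNum {x w : A} (h : Commute x w) (s : ℝ) : Commute x (cayNum s w) :=
  ((Commute.one_right x).smul_right _).add_right (h.smul_right _)

theorem commute_cay {x w : A} (h : Commute x w) (s : ℝ) : Commute x (cay s w) :=
  (commute_cayNum h s).mul_right (commute_ringInverse (commute_cayDen h s))

theorem cay_zero {w : A} (hw : ‖w - 1‖ < 2) : cay 0 w = 1 := by
  have : cayNum 0 w = cayDen 0 w := by simp [cayNum, cayDen]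
  rw [cay, this, Ring.mul_inverse_cancel _ (isUnit_cayDen (by simp) hw)]

theorem cay_one {w : A} (hw : ‖w - 1‖ < 2) : cay 1 w = w := by
  have h : cayNum 1 w = w * cayDen 1 w := by simp [cayNum, cayDen]
  rw [cay, h, mul_assoc, Ring.mul_inverse_cancel _ (isUnit_cayDen (by simp) hw), mul_one]

/-- The path is a rational function of `w` with real coefficients, hence compatible with
conjugation, adjoints and commutants. Moving along it therefore preserves relations such as `b w b⁻¹
= w⁻¹`. -/
theorem cay_conj {u v x w : A} (hvu : v * u = 1) (huv : u * v = 1) (hx : x = u * w * v)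
    {s : ℝ} (hs : s ∈ Set.Icc (0 : ℝ) 1) (hw : ‖w - 1‖ < 2) :
    cay s x = u * cay s w * v := by
  have hD : cayDen s x = u * cayDen s w * v := by
    simp only [cayDen, hx, mul_add, add_mul, mul_smul_comm, smul_mul_assoc, mul_one, huv]
  have hN : cayNum s x = u * cayNum s w * v := by
    simp only [cayNum, hx, mul_add, add_mul, mul_smul_comm, smul_mul_assoc, mul_one, huv]
  have h1 := isUnit_cayDen hs hw
  have hinv : Ring.inverse (cayDen s x) = u * Ring.inverse (cayDen s w) * v := by
    rw [hD]
    apply ringInverse_eq_of_mul_eq_one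
    · calc u * cayDen s w * v * (u * Ring.inverse (cayDen s w) * v)
          = u * (cayDen s w * (v * u) * Ring.inverse (cayDen s w)) * v := by noncomm_ring
        _ = 1 := by rw [hvu, mul_one, Ring.mul_inverse_cancel _ h1, mul_one, huv]
    · calc u * Ring.inverse (cayDen s w) * v * (u * cayDen s w * v)
          = u * (Ring.inverse (cayDen s w) * (v * u) * cayDen s w) * v := by noncomm_ring
        _ = 1 := by rw [hvu, mul_one, Ring.inverse_mul_cancel _ h1, mul_one, huv]
  rw [cay, hinv, hN, cay]
  calc u * cayNum s w * v * (u * Ring.inverse (cayDen s w) * v)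
      = u * (cayNum s w * (v * u) * Ring.inverse (cayDen s w)) * v := by noncomm_ring
    _ = _ := by rw [hvu, mul_one]

theorem star_cayDen (s : ℝ) (w : A) : star (cayDen s w) = cayDen s (star w) := by
  simp [cayDen]

theorem star_cayNum (s : ℝ) (w : A) : star (cayNum s w) = cayNum s (star w) := by
  simp [cayNum]

theorem star_cay (s : ℝ) (w : A) : star (cay s w) = cay s (star w) := by
  rw [cay, star_mul, ← Ring.inverse_star, star_cayDen, star_cayNum, cay]
  have h : Commute (star w) (cayNum s (star w)) := commute_cayNum (Commute.refl _) s
  have h2 : Commute (cayNum s (star w)) (cayDen s (star w)) :=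
    commute_cayDen h.symm s
  exact (commute_ringInverse h2).symm.eq

/-- Since `w` is unitary, the numerator at `w` is `w` times the denominator at `star w`, and vice
versa. In the product of `cay s w` and its adjoint the denominators cancel and `w * star w` remains.
-/
theorem cay_mem_unitary {s : ℝ} (hs : s ∈ Set.Icc (0 : ℝ) 1) {w : A} (hu : w ∈ unitary A)
    (hw : ‖w - 1‖ < 2) : cay s w ∈ unitary A := by
  have hD := isUnit_cayDen hs hw
  have hw' : ‖star w - 1‖ < 2 := by
    have : star w - 1 = star (w - 1) := by simp
    rwa [this, norm_star]
  have hD' := isUnit_cayDen hs hw'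
  have hsw := Unitary.star_mul_self_of_mem hu
  have hws := Unitary.mul_star_self_of_mem hu
  have hN : cayNum s w = w * cayDen s (star w) := by
    simp only [cayNum, cayDen, mul_add, mul_smul_comm, mul_one, hws]; abel
  have hN' : cayNum s (star w) = cayDen s w * star w := by
    simp only [cayNum, cayDen, add_mul, smul_mul_assoc, one_mul, hws]; abel
  have key : cay s (star w) * cay s w = 1 := by
    have hc : Commute (cay s (star w)) (cay s w) := by
      have h0 : Commute w (star w) := by rw [commute_iff_eq, hws, hsw]
      exact commute_cay (commute_cay h0 s).symm s
    rw [hc.eq, cay, cay, hN, hN']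
    have hc2 : Commute (cayDen s (star w)) (cayDen s w) := by
      have h0 : Commute w (star w) := by rw [commute_iff_eq, hws, hsw]
      exact commute_cayDen (commute_cayDen h0 s).symm s
    have hc3 : cayDen s (star w) * star w = star w * cayDen s (star w) :=
      (commute_cayDen (Commute.refl (star w)) s).eq.symm
    calc w * cayDen s (star w) * Ring.inverse (cayDen s w) *
          (cayDen s w * star w * Ring.inverse (cayDen s (star w)))
        = w * cayDen s (star w) * (Ring.inverse (cayDen s w) * cayDen s w) * star w *
          Ring.inverse (cayDen s (star w)) := by noncomm_ring
      _ = w * (cayDen s (star w) * star w) * Ring.inverse (cayDen s (star w)) := by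
          rw [Ring.inverse_mul_cancel _ hD, mul_one, mul_assoc w]
      _ = (w * star w) * (cayDen s (star w) * Ring.inverse (cayDen s (star w))) := by
          rw [hc3]; noncomm_ring
      _ = 1 := by rw [hws, Ring.mul_inverse_cancel _ hD', one_mul]
  have hc : Commute (cay s (star w)) (cay s w) := by
    have h0 : Commute w (star w) := by rw [commute_iff_eq, hws, hsw]
    exact commute_cay (commute_cay h0 s).symm s
  rw [Unitary.mem_iff, star_cay s w]
  exact ⟨key, by rw [← hc.eq, key]⟩

/-- Multiplying `x = cay s w - 1` by the denominator gives `2s (w - 1)`. With `‖w - 1‖ ≤ 1` this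
yields `(1 + s) ‖x‖ ≤ 2s ‖w - 1‖`. -/
theorem norm_cay_sub_one_le {s : ℝ} (hs : s ∈ Set.Icc (0 : ℝ) 1) {w : A}
    (hw : ‖w - 1‖ ≤ 1) : ‖cay s w - 1‖ ≤ 2 * ‖w - 1‖ := by
  have hw2 : ‖w - 1‖ < 2 := by linarith
  have hD := isUnit_cayDen hs hw2
  set x := cay s w - 1 with hx
  have h1 : x * cayDen s w = ((2 * s : ℝ) : ℂ) • (w - 1) := by
    rw [hx, sub_mul, cay, mul_assoc, Ring.inverse_mul_cancel _ hD, mul_one, one_mul, cayNum, cayDen]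
    push_cast; module
  have h2 : (2 : ℂ) • x = ((2 * s : ℝ) : ℂ) • (w - 1) - ((1 - s : ℝ) : ℂ) • (x * (w - 1)) := by
    rw [← h1, cayDen_eq, mul_add, mul_smul_comm, mul_smul_comm, mul_one]; abel
  have h3 : 2 * ‖x‖ ≤ 2 * s * ‖w - 1‖ + (1 - s) * ‖x‖ := by
    calc 2 * ‖x‖ = ‖(2 : ℂ) • x‖ := by rw [norm_smul]; simp
      _ ≤ ‖((2 * s : ℝ) : ℂ) • (w - 1)‖ + ‖((1 - s : ℝ) : ℂ) • (x * (w - 1))‖ := by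
          rw [h2]; exact norm_sub_le _ _
      _ = 2 * s * ‖w - 1‖ + (1 - s) * ‖x * (w - 1)‖ := by
          rw [norm_smul, norm_smul, Complex.norm_real, Complex.norm_real, Real.norm_of_nonneg (by linarith [hs.1]),
            Real.norm_of_nonneg (by linarith [hs.2])]
      _ ≤ _ := by
          gcongr
          · linarith [hs.2]
          · calc ‖x * (w - 1)‖ ≤ ‖x‖ * ‖w - 1‖ := norm_mul_le _ _
              _ ≤ ‖x‖ * 1 := by gcongr
              _ = ‖x‖ := mul_one _
  nlinarith [hs.1, hs.2, norm_nonneg x, norm_nonneg (w - 1)]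

theorem continuousOn_cay :
    ContinuousOn (fun p : ℝ × A => cay p.1 p.2) {p | p.1 ∈ Set.Icc (0 : ℝ) 1 ∧ ‖p.2 - 1‖ < 2} := by
  have hN : Continuous fun p : ℝ × A => cayNum p.1 p.2 := by
    unfold cayNum; fun_prop
  have hD : Continuous fun p : ℝ × A => cayDen p.1 p.2 := by
    unfold cayDen; fun_prop
  refine hN.continuousOn.mul fun p hp => ?_
  have h := isUnit_cayDen hp.1 hp.2
  obtain ⟨v, hv⟩ := h
  have := NormedRing.inverse_continuousAt v
  rw [hv] at this
  exact (ContinuousAt.comp (f := fun p : ℝ × A => cayDen p.1 p.2) this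
    hD.continuousAt).continuousWithinAt

end Cayley


/-! ### The unitary part in the polar decomposition -/

section Polar

variable {A : Type*} [CStarAlgebra A] [PartialOrder A] [StarOrderedRing A]

/-- The absolute value `√(x* x)`. -/
noncomputable def absC (x : A) : A := CFC.abs x

theorem absC_nonneg (x : A) : 0 ≤ absC x := CFC.abs_nonneg x

theorem absC_sq (x : A) : absC x ^ 2 = star x * x := CFC.abs_sq x

theorem absC_mul_absC (x : A) : absC x * absC x = star x * x := CFC.abs_mul_abs x

/-- The unitary part of an invertible element. -/
noncomputable def pol (x : A) : A := x * Ring.inverse (absC x)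

theorem isUnit_abs {x : A} (hx : IsUnit x) : IsUnit (absC x) := by
  have h : IsUnit (absC x ^ 2) := by
    rw [absC_sq]; exact hx.star.mul hx
  exact (isUnit_pow_iff two_ne_zero).mp h

theorem pol_mul_abs {x : A} (hx : IsUnit x) : pol x * absC x = x := by
  rw [pol, mul_assoc, Ring.inverse_mul_cancel _ (isUnit_abs hx), mul_one]

theorem star_inverse_abs (x : A) :
    star (Ring.inverse (absC x)) = Ring.inverse (absC x) := by
  rw [← Ring.inverse_star, (IsSelfAdjoint.of_nonneg (absC_nonneg x)).star_eq]

theorem pol_mem_unitary {x : A} (hx : IsUnit x) : pol x ∈ unitary A := by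
  have hu := isUnit_abs hx
  have h1 : star (pol x) * pol x = 1 := by
    rw [pol, star_mul, star_inverse_abs]
    calc Ring.inverse (absC x) * star x * (x * Ring.inverse (absC x))
        = Ring.inverse (absC x) * (star x * x) * Ring.inverse (absC x) := by noncomm_ring
      _ = (Ring.inverse (absC x) * absC x) * (absC x * Ring.inverse (absC x)) := by
          rw [← absC_mul_absC]; noncomm_ring
      _ = 1 := by rw [Ring.inverse_mul_cancel _ hu, Ring.mul_inverse_cancel _ hu, one_mul]
  have h2 : IsUnit (pol x) := hx.mul hu.ringInverse
  refine Unitary.mem_iff.mpr ⟨h1, ?_⟩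
  obtain ⟨v, hv⟩ := h2
  rw [← hv] at h1 ⊢
  have h3 : star (v : A) = ↑v⁻¹ := Units.eq_inv_of_mul_eq_one_right h1
  rw [h3, Units.mul_inv]

/-- On the spectrum of `|x|` one has `|1 - t| ≤ |1 - t| (1 + t) = |1 - t ^ 2|`, because `t ≥ 0`. -/
theorem norm_one_sub_abs_le (x : A) : ‖1 - absC x‖ ≤ ‖1 - star x * x‖ := by
  set y := absC x with hy
  have hy0 : 0 ≤ y := absC_nonneg x
  have hsa : IsSelfAdjoint y := IsSelfAdjoint.of_nonneg hy0
  have h1 : 1 - y = cfc (fun t : ℝ => 1 - t) y := by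
    rw [cfc_sub (fun _ => (1 : ℝ)) (fun t => t) y, cfc_const_one ℝ y, cfc_id' ℝ y]
  have h2 : 1 - star x * x = cfc (fun t : ℝ => 1 - t ^ 2) y := by
    rw [cfc_sub (fun _ => (1 : ℝ)) (fun t => t ^ 2) y, cfc_const_one ℝ y, cfc_pow_id y 2, hy,
      absC_sq]
  rw [h1, h2]
  refine norm_cfc_le (norm_nonneg _) fun t ht => ?_
  have ht0 : 0 ≤ t := spectrum_nonneg_of_nonneg hy0 ht
  have h3 := norm_apply_le_norm_cfc (fun t : ℝ => 1 - t ^ 2) y ht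
  refine le_trans ?_ h3
  have : (1 : ℝ) - t ^ 2 = (1 - t) * (1 + t) := by ring
  rw [this, norm_mul, Real.norm_of_nonneg (by linarith : 0 ≤ 1 + t)]
  nlinarith [norm_nonneg (1 - t)]

theorem norm_pol_sub_le {x : A} (hx : IsUnit x) : ‖pol x - x‖ ≤ ‖1 - star x * x‖ := by
  have h : pol x - x = pol x * (1 - absC x) := by
    rw [mul_sub, mul_one, pol_mul_abs hx]
  rw [h, CStarRing.norm_mem_unitary_mul _ (pol_mem_unitary hx)]
  exact norm_one_sub_abs_le x

theorem norm_pol_sub_unitary_le {x u : A} (hu : u ∈ unitary A) (h : ‖x - u‖ ≤ 1 / 4) :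
    ‖pol x - u‖ ≤ 4 * ‖x - u‖ := by
  have hx : IsUnit x := isUnit_of_norm_sub_unitary_lt hu (by linarith)
  have h1 : 1 - star x * x = star u * (u - x) + (star u - star x) * x := by
    rw [mul_sub, Unitary.star_mul_self_of_mem hu]; noncomm_ring
  have h0 : ‖x‖ ≤ 5 / 4 := by
    have hu1 : ‖u‖ ≤ 1 := by
      have := CStarRing.norm_mem_unitary_mul (1 : A) hu
      rcases subsingleton_or_nontrivial A with h' | h'
      · rw [Subsingleton.elim u 0]; simp
      · simp [CStarRing.norm_of_mem_unitary hu]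
    calc ‖x‖ = ‖(x - u) + u‖ := by simp
      _ ≤ ‖x - u‖ + ‖u‖ := norm_add_le _ _
      _ ≤ _ := by linarith
  -- The factor is `1 + ‖x‖ ≤ 1 + 5 / 4`; adding `‖x - u‖` once more stays below the final constant
  -- `4`.
  have h2 : ‖1 - star x * x‖ ≤ 9 / 4 * ‖x - u‖ := by
    rw [h1]
    refine (norm_add_le _ _).trans ?_
    rw [CStarRing.norm_mem_unitary_mul _ (Unitary.star_mem hu), ← star_sub]
    have := norm_mul_le (star (u - x)) x
    rw [norm_star] at this
    rw [norm_sub_rev u x] at *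
    nlinarith [norm_nonneg (x - u)]
  have h3 := norm_pol_sub_le hx
  calc ‖pol x - u‖ = ‖(pol x - x) + (x - u)‖ := by simp
    _ ≤ ‖pol x - x‖ + ‖x - u‖ := norm_add_le _ _
    _ ≤ _ := by linarith [norm_nonneg (x - u)]

theorem commute_abs {x a : A} (h : Commute a (star x * x)) : Commute a (absC x) := by
  exact (Commute.cfcₙ_nnreal h.symm _).symm

/-- Taking adjoints in `x a = a' x` shows that `a` commutes with `x* x`, hence with `|x|`. So an
exact intertwiner can be replaced by a unitary one. -/
theorem pol_mul {x a a' : A} (ha : a ∈ unitary A) (ha' : a' ∈ unitary A) (h : x * a = a' * x) :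
    pol x * a = a' * pol x := by
  have h1 : star x * a' = a * star x := by
    have h2 : star a' * x = x * star a := by
      calc star a' * x = star a' * (x * a) * star a := by
            rw [mul_assoc, mul_assoc, Unitary.mul_star_self_of_mem ha, mul_one]
        _ = (star a' * a') * (x * star a) := by rw [h]; noncomm_ring
        _ = _ := by rw [Unitary.star_mul_self_of_mem ha', one_mul]
    have := congrArg star h2
    simpa using this
  have h3 : Commute a (star x * x) := by
    rw [commute_iff_eq, ← mul_assoc, ← h1, mul_assoc, mul_assoc, h]
  have h4 := commute_ringInverse (commute_abs h3)
  rw [pol, mul_assoc, ← h4.eq, ← mul_assoc, h, mul_assoc]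

theorem pol_isSelfAdjoint {x : A} (hx : IsSelfAdjoint x) : IsSelfAdjoint (pol x) := by
  have h : Commute x (absC x) := (CFC.commute_abs_self x hx.isStarNormal).symm
  rw [isSelfAdjoint_iff, pol, star_mul, star_inverse_abs, hx.star_eq]
  exact (commute_ringInverse h).eq.symm

end Polar


/-! ### Elements of `U_∞` -/

theorem dist_eq_norm_opU (u v : UInf) : dist u v = ‖opU u - opU v‖ := by
  rw [← dist_eq_norm]; rfl

theorem opU_injective : Function.Injective opU := fun _ _ h => Subtype.ext (Subtype.ext h)

@[simp] theorem opU_one : opU 1 = 1 := rfl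

@[simp] theorem opU_mul (u v : UInf) : opU (u * v) = opU u * opU v := rfl

@[simp] theorem opU_inv (u : UInf) : opU u⁻¹ = star (opU u) := rfl

@[simp] theorem opU_pow (u : UInf) (k : ℕ) : opU (u ^ k) = opU u ^ k := by
  induction k with
  | zero => rfl
  | succ k ih => rw [pow_succ, pow_succ, opU_mul, ih]

theorem opU_mem_unitary (u : UInf) : opU u ∈ unitary (Hil →L[ℂ] Hil) := u.1.2

theorem opU_mul_star (u : UInf) : opU u * star (opU u) = 1 :=
  Unitary.mul_star_self_of_mem (opU_mem_unitary u)

theorem star_mul_opU (u : UInf) : star (opU u) * opU u = 1 :=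
  Unitary.star_mul_self_of_mem (opU_mem_unitary u)

theorem continuous_opU : Continuous opU := continuous_subtype_val.comp continuous_subtype_val

theorem norm_opU_mul (u : UInf) (x : Hil →L[ℂ] Hil) : ‖opU u * x‖ = ‖x‖ :=
  CStarRing.norm_mem_unitary_mul _ (opU_mem_unitary u)

theorem norm_mul_opU (u : UInf) (x : Hil →L[ℂ] Hil) : ‖x * opU u‖ = ‖x‖ :=
  CStarRing.norm_mul_mem_unitary _ (opU_mem_unitary u)

theorem dist_mul_left_UInf (w u v : UInf) : dist (w * u) (w * v) = dist u v := by
  rw [dist_eq_norm_opU, dist_eq_norm_opU, opU_mul, opU_mul, ← mul_sub, norm_opU_mul]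

theorem dist_mul_right_UInf (u v w : UInf) : dist (u * w) (v * w) = dist u v := by
  rw [dist_eq_norm_opU, dist_eq_norm_opU, opU_mul, opU_mul, ← sub_mul, norm_mul_opU]

theorem dist_inv_UInf (u v : UInf) : dist u⁻¹ v⁻¹ = dist u v := by
  rw [← dist_mul_left_UInf u, ← dist_mul_right_UInf _ _ v]
  simp [dist_comm]

theorem dist_mul_mul_le_UInf (u v u' v' : UInf) :
    dist (u * v) (u' * v') ≤ dist u u' + dist v v' :=
  (dist_triangle _ (u' * v) _).trans_eq (by rw [dist_mul_right_UInf, dist_mul_left_UInf])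

/-- An operator fixing all but finitely many of the standard basis vectors. -/
def Fixes (x : Hil →L[ℂ] Hil) : Prop := ∃ n : ℕ, ∀ k, n ≤ k → x (basisVec k) = basisVec k

/-- The element of `U_∞` given by a unitary fixing almost all basis vectors. -/
def mkU (x : Hil →L[ℂ] Hil) (hx : x ∈ unitary (Hil →L[ℂ] Hil)) (hf : Fixes x) : UInf :=
  ⟨⟨x, hx⟩, hf⟩

@[simp] theorem opU_mkU (x : Hil →L[ℂ] Hil) (hx : x ∈ unitary (Hil →L[ℂ] Hil)) (hf : Fixes x) :
    opU (mkU x hx hf) = x := rfl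

theorem fixes_opU (u : UInf) : Fixes (opU u) := u.2

theorem Fixes.mul {x y : Hil →L[ℂ] Hil} (hx : Fixes x) (hy : Fixes y) : Fixes (x * y) := by
  obtain ⟨m, hm⟩ := hx
  obtain ⟨n, hn⟩ := hy
  refine ⟨max m n, fun k hk => ?_⟩
  change x (y (basisVec k)) = _
  rw [hn k ((le_max_right _ _).trans hk), hm k ((le_max_left _ _).trans hk)]

theorem Fixes.inverse {x : Hil →L[ℂ] Hil} (hx : Fixes x) (hu : IsUnit x) :
    Fixes (Ring.inverse x) := by
  obtain ⟨n, hn⟩ := hx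
  refine ⟨n, fun k hk => ?_⟩
  have h : (Ring.inverse x * x) (basisVec k) = basisVec k := by
    rw [Ring.inverse_mul_cancel _ hu]; rfl
  change Ring.inverse x (x (basisVec k)) = _ at h
  rwa [hn k hk] at h

theorem Fixes.average {ι : Type*} {s : Finset ι} (hs : s.Nonempty) {f : ι → Hil →L[ℂ] Hil}
    (hf : ∀ i ∈ s, Fixes (f i)) : Fixes ((s.card : ℂ)⁻¹ • ∑ i ∈ s, f i) := by
  choose! n hn using hf
  refine ⟨s.sup n, fun k hk => ?_⟩
  have h : ∀ i ∈ s, f i (basisVec k) = basisVec k := fun i hi =>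
    hn i hi k ((Finset.le_sup hi).trans hk)
  have hc : (s.card : ℂ) ≠ 0 := by exact_mod_cast hs.card_ne_zero
  rw [smul_apply, sum_apply, Finset.sum_congr rfl h,
    Finset.sum_const, ← Nat.cast_smul_eq_nsmul ℂ, smul_smul, inv_mul_cancel₀ hc, one_smul]

theorem Fixes.cay {s : ℝ} (hs : s ∈ Set.Icc (0 : ℝ) 1) {w : Hil →L[ℂ] Hil} (hf : Fixes w)
    (hw : ‖w - 1‖ < 2) : Fixes (cay s w) := by
  obtain ⟨n, hn⟩ := hf
  have hD := isUnit_cayDen hs hw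
  refine ⟨n, fun k hk => ?_⟩
  have h1 : cayDen s w (basisVec k) = (2 : ℂ) • basisVec k := by
    simp only [cayDen, add_apply, smul_apply, hn k hk,
      one_apply_eq_self, ← add_smul]
    congr 1; push_cast; ring
  have h2 : cayNum s w (basisVec k) = (2 : ℂ) • basisVec k := by
    simp only [cayNum, add_apply, smul_apply, hn k hk,
      one_apply_eq_self, ← add_smul]
    congr 1; push_cast; ring
  have h3 : (Ring.inverse (cayDen s w) * cayDen s w) (basisVec k) = basisVec k := by
    rw [Ring.inverse_mul_cancel _ hD]; rfl
  change Ring.inverse (cayDen s w) (cayDen s w (basisVec k)) = _ at h3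
  have h4 : cayDen s w (basisVec k) = cayNum s w (basisVec k) := by rw [h1, h2]
  have hc : Commute (cayNum s w) (Ring.inverse (cayDen s w)) :=
    commute_ringInverse (commute_cayDen (commute_cayNum (Commute.refl w) s).symm s)
  rw [AsymRep.cay, hc.eq]
  change Ring.inverse (cayDen s w) (cayNum s w (basisVec k)) = _
  rw [← h4, h3]

/-- Here `|x| ^ 2 e = e`, so `|x| e - e` lies in the `-1` eigenspace of a positive operator and
vanishes. -/
theorem abs_apply_eq_self {x : Hil →L[ℂ] Hil} {e : Hil} (h : x e = e) (h' : star x e = e) :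
    absC x e = e := by
  set y := absC x with hy
  have hpos : y.IsPositive := (ContinuousLinearMap.nonneg_iff_isPositive y).mp (absC_nonneg x)
  have h2 : y (y e) = e := by
    have : (y * y) e = (star x * x) e := by rw [hy, absC_mul_absC]
    change y (y e) = star x (x e) at this
    rw [this, h, h']
  have h3 : y (y e - e) = -(y e - e) := by rw [map_sub, h2]; abel
  have h4 := hpos.re_inner_nonneg_left (y e - e)
  rw [h3, inner_neg_left, map_neg, inner_self_eq_norm_sq] at h4
  have h5 : ‖y e - e‖ = 0 := by nlinarith [norm_nonneg (y e - e)]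
  exact sub_eq_zero.mp (norm_eq_zero.mp h5)

theorem Fixes.pol {x : Hil →L[ℂ] Hil} (hx : Fixes x) (hx' : Fixes (star x)) (hu : IsUnit x) :
    Fixes (pol x) := by
  refine hx.mul (Fixes.inverse ?_ (isUnit_abs hu))
  obtain ⟨m, hm⟩ := hx
  obtain ⟨n, hn⟩ := hx'
  exact ⟨max m n, fun k hk => abs_apply_eq_self (hm k ((le_max_left _ _).trans hk))
    (hn k ((le_max_right _ _).trans hk))⟩

theorem basisVec_apply_self (k : ℕ) : (basisVec k : ℕ → ℂ) k = 1 := by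
  simp [basisVec]

theorem basisVec_apply_ne {k j : ℕ} (h : j ≠ k) : (basisVec k : ℕ → ℂ) j = 0 := by
  simp [basisVec, h]

theorem basisVec_ne_zero (k : ℕ) : basisVec k ≠ 0 := fun h => by
  have := basisVec_apply_self k
  rw [h] at this
  simp at this

theorem inner_basisVec (k : ℕ) (ξ : Hil) : inner ℂ (basisVec k) ξ = ξ k := by
  rw [basisVec, lp.inner_single_left]; simp

instance : Nontrivial Hil := ⟨basisVec 0, 0, basisVec_ne_zero 0⟩

/-- A vector supported on the first `n` coordinates is a combination of basis vectors. -/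
theorem eq_sum_basisVec {n : ℕ} {ξ : Hil} (h : ∀ k, n ≤ k → ξ k = 0) :
    ξ = ∑ i : Fin n, ξ (i : ℕ) • basisVec i := by
  ext k
  rw [lp.coeFn_sum, Finset.sum_apply]
  by_cases hk : k < n
  · rw [Finset.sum_eq_single ⟨k, hk⟩]
    · simp [basisVec_apply_self]
    · intro j _ hj
      have : k ≠ j := fun h => hj (Fin.ext h.symm)
      simp [basisVec_apply_ne this]
    · simp
  · rw [h k (not_lt.mp hk), Finset.sum_eq_zero]
    intro j _
    have : k ≠ j := fun h => hk (h ▸ j.2)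
    simp [basisVec_apply_ne this]

theorem levelU_apply_coord {n : ℕ} {u : UInf} (hu : (u : unitary (Hil →L[ℂ] Hil)) ∈ levelU n) (ξ : Hil) {k : ℕ}
    (hk : n ≤ k) : opU u ξ k = ξ k := by
  have h1 : star (opU u) (basisVec k) = basisVec k := (levelU n).inv_mem hu k hk
  rw [← inner_basisVec, ← ContinuousLinearMap.adjoint_inner_left,
    ← ContinuousLinearMap.star_eq_adjoint, h1, inner_basisVec]

/-! ### Rank of `u - 1` and the number of eigenvalues. -/

/-- The dimension of the range of `u - 1`. -/
noncomputable def rk (u : UInf) : ℕ :=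
  Module.finrank ℂ (LinearMap.range ((opU u - 1 : Hil →L[ℂ] Hil) : Hil →ₗ[ℂ] Hil))

instance finiteDimensional_range_sub_one (u : UInf) :
    FiniteDimensional ℂ (LinearMap.range ((opU u - 1 : Hil →L[ℂ] Hil) : Hil →ₗ[ℂ] Hil)) := by
  obtain ⟨n, hn⟩ := u.2
  have hfin : FiniteDimensional ℂ
      (Submodule.span ℂ (Set.range fun i : Fin n => basisVec i)) :=
    FiniteDimensional.span_of_finite ℂ (Set.finite_range _)
  refine Submodule.finiteDimensional_of_le (S₂ := Submodule.span ℂ (Set.range fun i : Fin n => basisVec i)) ?_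
  rintro _ ⟨ξ, rfl⟩
  rw [eq_sum_basisVec (n := n) (ξ := ((opU u - 1 : Hil →L[ℂ] Hil) : Hil →ₗ[ℂ] Hil) ξ)]
  · exact Submodule.sum_mem _ fun i _ => Submodule.smul_mem _ _ (Submodule.subset_span ⟨i, rfl⟩)
  · intro k hk
    have := levelU_apply_coord hn ξ hk
    simp [this]

theorem rk_mul_le (u v : UInf) : rk (u * v) ≤ rk u + rk v := by
  have h : LinearMap.range ((opU (u * v) - 1 : Hil →L[ℂ] Hil) : Hil →ₗ[ℂ] Hil) ≤
      LinearMap.range ((opU u - 1 : Hil →L[ℂ] Hil) : Hil →ₗ[ℂ] Hil) ⊔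
      LinearMap.range ((opU v - 1 : Hil →L[ℂ] Hil) : Hil →ₗ[ℂ] Hil) := by
    rintro _ ⟨ξ, rfl⟩
    have : ((opU (u * v) - 1 : Hil →L[ℂ] Hil) : Hil →ₗ[ℂ] Hil) ξ =
        ((opU u - 1 : Hil →L[ℂ] Hil) : Hil →ₗ[ℂ] Hil) (opU v ξ) +
        ((opU v - 1 : Hil →L[ℂ] Hil) : Hil →ₗ[ℂ] Hil) ξ := by
      simp
    rw [this]
    exact Submodule.add_mem_sup ⟨_, rfl⟩ ⟨_, rfl⟩
  exact (Submodule.finrank_mono h).trans (Submodule.finrank_add_le_finrank_add_finrank _ _)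

theorem rk_conj (w u : UInf) : rk (w * u * w⁻¹) ≤ rk u := by
  have h : LinearMap.range ((opU (w * u * w⁻¹) - 1 : Hil →L[ℂ] Hil) : Hil →ₗ[ℂ] Hil) ≤
      (LinearMap.range ((opU u - 1 : Hil →L[ℂ] Hil) : Hil →ₗ[ℂ] Hil)).map
        ((opU w : Hil →L[ℂ] Hil) : Hil →ₗ[ℂ] Hil) := by
    rintro _ ⟨ξ, rfl⟩
    refine ⟨_, ⟨star (opU w) ξ, rfl⟩, ?_⟩
    have : opU w (star (opU w) ξ) = ξ := by
      have := congrArg (fun x : Hil →L[ℂ] Hil => x ξ) (opU_mul_star w)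
      exact this
    simp [this]
  exact (Submodule.finrank_mono h).trans (Submodule.finrank_map_le _ _)

/-- Let `G` be `u - 1` restricted to its finite-dimensional range. By Cayley–Hamilton the
characteristic polynomial of `G` times `X` annihilates `u - 1`; the factor `X`, which maps into the
range, accounts for the extra `1`. -/
theorem spectrum_finite_and_ncard_le (u : UInf) :
    (spectrum ℂ (opU u)).Finite ∧ (spectrum ℂ (opU u)).ncard ≤ rk u + 1 := by
  classical
  set F : Hil →L[ℂ] Hil := opU u - 1 with hF
  set R := LinearMap.range (F : Hil →ₗ[ℂ] Hil) with hR
  have hmap : ∀ x ∈ R, (F : Hil →ₗ[ℂ] Hil) x ∈ R := fun x _ => ⟨x, rfl⟩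
  set G : R →ₗ[ℂ] R := (F : Hil →ₗ[ℂ] Hil).restrict hmap with hG
  have hcoe : ∀ (p : Polynomial ℂ) (x : R),
      ((Polynomial.aeval G p x : R) : Hil) = Polynomial.aeval F p (x : Hil) := by
    intro p
    induction p using Polynomial.induction_on' with
    | add p q hp hq => intro x; simp [hp, hq]
    | monomial k c =>
      intro x
      have : ∀ x : R, (((G ^ k) x : R) : Hil) = (F ^ k) (x : Hil) := by
        induction k with
        | zero => intro x; simp
        | succ k ih => intro x; rw [pow_succ, pow_succ]; exact ih (G x)
      simp [Polynomial.aeval_monomial, this, Algebra.algebraMap_eq_smul_one]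
  set q : Polynomial ℂ := G.charpoly * Polynomial.X with hq
  have hq0 : Polynomial.aeval F q = 0 := by
    ext1 ξ
    have h1 := hcoe G.charpoly ⟨F ξ, ξ, rfl⟩
    rw [LinearMap.aeval_self_charpoly] at h1
    simp only [hq, map_mul, Polynomial.aeval_X]
    exact h1.symm
  have hqne : q ≠ 0 := mul_ne_zero (LinearMap.charpoly_monic G).ne_zero Polynomial.X_ne_zero
  have hdeg : q.natDegree = rk u + 1 := by
    rw [hq, Polynomial.natDegree_mul_X (LinearMap.charpoly_monic G).ne_zero,
      LinearMap.charpoly_natDegree]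
    rfl
  have hsub : spectrum ℂ (opU u) ⊆ (fun z => z + 1) '' (q.roots.toFinset : Set ℂ) := by
    intro z hz
    refine ⟨z - 1, ?_, by ring⟩
    have hz' : z - 1 ∈ spectrum ℂ F := by
      rw [spectrum.mem_iff] at hz ⊢
      convert! hz using 2
      rw [hF, map_sub, map_one]; abel
    have h2 := spectrum.subset_polynomial_aeval F q ⟨_, hz', rfl⟩
    rw [hq0, spectrum.zero_eq, Set.mem_singleton_iff] at h2
    simp [hqne, h2]
  have hfin : ((fun z => z + 1) '' (q.roots.toFinset : Set ℂ)).Finite :=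
    (Finset.finite_toSet _).image _
  refine ⟨hfin.subset hsub, (Set.ncard_le_ncard hsub hfin).trans ?_⟩
  refine (Set.ncard_image_le (Finset.finite_toSet _)).trans ?_
  rw [Set.ncard_coe_finset, ← hdeg]
  exact (Multiset.toFinset_card_le _).trans (Polynomial.card_roots' q)

theorem one_mem_spectrum (u : UInf) : (1 : ℂ) ∈ spectrum ℂ (opU u) := by
  obtain ⟨n, hn⟩ := u.2
  rw [spectrum.mem_iff]
  intro h
  have h1 : (algebraMap ℂ (Hil →L[ℂ] Hil) 1 - opU u) (basisVec n) = 0 := by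
    have : opU u (basisVec n) = basisVec n := hn n le_rfl
    simp [this]
  have h2 : (Ring.inverse (algebraMap ℂ (Hil →L[ℂ] Hil) 1 - opU u) *
      (algebraMap ℂ (Hil →L[ℂ] Hil) 1 - opU u)) (basisVec n) = basisVec n := by
    rw [Ring.inverse_mul_cancel _ h]; rfl
  change (Ring.inverse (algebraMap ℂ (Hil →L[ℂ] Hil) 1 - opU u) : Hil →L[ℂ] Hil)
    ((algebraMap ℂ (Hil →L[ℂ] Hil) 1 - opU u) (basisVec n)) = _ at h2
  rw [h1, map_zero] at h2
  exact basisVec_ne_zero n h2.symm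

/-- The spectrum is finite, so `f(u)` is an interpolating polynomial in `u`, which acts on a fixed
vector of `u` as the scalar `f 1`. -/
theorem fixes_cfc (u : UInf) {f : ℂ → ℂ} (hf : f 1 = 1) : Fixes (cfc f (opU u)) := by
  have hS := (spectrum_finite_and_ncard_le u).1
  have hnorm : IsStarNormal (opU u) := isStarNormal_of_mem_unitary (opU_mem_unitary u)
  set p := Lagrange.interpolate hS.toFinset id f with hp
  have hpe : ∀ z ∈ spectrum ℂ (opU u), p.eval z = f z := fun z hz =>
    Lagrange.eval_interpolate_at_node (v := id) f (fun _ _ _ _ h => h) (hS.mem_toFinset.mpr hz)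
  have h1 : cfc f (opU u) = Polynomial.aeval (opU u) p := by
    rw [← cfc_polynomial p (opU u)]
    exact cfc_congr fun z hz => (hpe z hz).symm
  obtain ⟨n, hn⟩ := u.2
  refine ⟨n, fun k hk => ?_⟩
  have he : opU u (basisVec k) = basisVec k := hn k hk
  have h2 : ∀ r : Polynomial ℂ, Polynomial.aeval (opU u) r (basisVec k) = r.eval 1 • basisVec k := by
    intro r
    induction r using Polynomial.induction_on' with
    | add p q hp hq => simp [hp, hq, add_smul]
    | monomial j c =>
      have : (opU u ^ j) (basisVec k) = basisVec k := by
        induction j with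
        | zero => rfl
        | succ j ih =>
          rw [pow_succ]
          change (opU u ^ j) (opU u (basisVec k)) = _
          rw [he, ih]
      simp [Polynomial.aeval_monomial, this, Algebra.algebraMap_eq_smul_one]
  rw [h1, h2, hpe 1 (one_mem_spectrum u), hf, one_smul]


/-! ### Uniform continuity of the functional calculus on unitaries -/

/-- The point is that `δ` depends on `f` alone. The estimate is clear for `z` and `star z`, passes
to sums, products and uniform limits, and so reaches every continuous function by Stone–Weierstrass.
-/
theorem cfc_uniform_on_unitary {A : Type*} [CStarAlgebra A] {f : ℂ → ℂ}
    (hf : ContinuousOn f (Metric.sphere 0 1)) {ε : ℝ} (hε : 0 < ε) :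
    ∃ δ > 0, ∀ u ∈ unitary A, ∀ v ∈ unitary A, ‖u - v‖ < δ → ‖cfc f u - cfc f v‖ < ε := by
  set K : Set ℂ := Metric.sphere 0 1 with hK
  have : CompactSpace K := isCompact_iff_compactSpace.mp (isCompact_sphere 0 1)
  have hn : ∀ u : unitary A, IsStarNormal (u : A) := fun u => isStarNormal_of_mem_unitary u.2
  have hs : ∀ u : unitary A, spectrum ℂ (u : A) ⊆ K := fun u => Unitary.spectrum_subset_circle u
  let Φ : unitary A → C(K, ℂ) →⋆ₐ[ℂ] A := fun u => cfcHomSuperset (hn u) (hs u)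
  have hΦn : ∀ u g, ‖Φ u g‖ ≤ ‖g‖ := fun u g => NonUnitalStarAlgHom.norm_apply_le (Φ u) g
  have hΦid : ∀ u, Φ u (.restrict K <| .id ℂ) = (u : A) := fun u => cfcHom_id (hn u)
  have key : ∀ g : C(K, ℂ), ∀ ε > 0, ∃ δ > 0, ∀ u v : unitary A, ‖(u : A) - v‖ < δ →
      ‖Φ u g - Φ v g‖ < ε := by
    intro g
    induction g using ContinuousMap.induction_on_of_compact with
    | const r =>
      intro ε hε
      refine ⟨1, one_pos, fun u v _ => ?_⟩
      have : (ContinuousMap.const K r) = algebraMap ℂ C(K, ℂ) r := rfl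
      rw [this, AlgHomClass.commutes, AlgHomClass.commutes, sub_self, norm_zero]
      exact hε
    | id => exact fun ε hε => ⟨ε, hε, fun u v h => by rwa [hΦid, hΦid]⟩
    | star_id =>
      refine fun ε hε => ⟨ε, hε, fun u v h => ?_⟩
      rwa [map_star, map_star, hΦid, hΦid, ← star_sub, norm_star]
    | add f g hf hg =>
      intro ε hε
      obtain ⟨δ₁, h₁, H₁⟩ := hf (ε / 2) (by positivity)
      obtain ⟨δ₂, h₂, H₂⟩ := hg (ε / 2) (by positivity)
      refine ⟨min δ₁ δ₂, lt_min h₁ h₂, fun u v h => ?_⟩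
      have e1 := H₁ u v (h.trans_le (min_le_left _ _))
      have e2 := H₂ u v (h.trans_le (min_le_right _ _))
      have : Φ u (f + g) - Φ v (f + g) = (Φ u f - Φ v f) + (Φ u g - Φ v g) := by
        rw [map_add, map_add]; abel
      rw [this]
      exact (norm_add_le _ _).trans_lt (by linarith)
    | mul f g hf hg =>
      intro ε hε
      obtain ⟨δ₁, h₁, H₁⟩ := hf (ε / (2 * (‖g‖ + 1))) (by positivity)
      obtain ⟨δ₂, h₂, H₂⟩ := hg (ε / (2 * (‖f‖ + 1))) (by positivity)
      refine ⟨min δ₁ δ₂, lt_min h₁ h₂, fun u v h => ?_⟩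
      have e1 := H₁ u v (h.trans_le (min_le_left _ _))
      have e2 := H₂ u v (h.trans_le (min_le_right _ _))
      have : Φ u (f * g) - Φ v (f * g) = (Φ u f - Φ v f) * Φ u g + Φ v f * (Φ u g - Φ v g) := by
        rw [map_mul, map_mul]; noncomm_ring
      rw [this]
      rw [lt_div_iff₀ (by positivity)] at e1 e2
      refine (norm_add_le _ _).trans_lt ?_
      have n1 := (norm_mul_le (Φ u f - Φ v f) (Φ u g)).trans
        (mul_le_mul_of_nonneg_left (hΦn u g) (norm_nonneg _))
      have n2 := (norm_mul_le (Φ v f) (Φ u g - Φ v g)).trans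
        (mul_le_mul_of_nonneg_right (hΦn v f) (norm_nonneg _))
      nlinarith [norm_nonneg (Φ u f - Φ v f), norm_nonneg (Φ u g - Φ v g)]
    | frequently f hf =>
      intro ε hε
      obtain ⟨g, hg, hd⟩ := (hf.and_eventually (Metric.ball_mem_nhds f (by positivity : 0 < ε / 3))).exists
      obtain ⟨δ, h, H⟩ := hg (ε / 3) (by positivity)
      refine ⟨δ, h, fun u v huv => ?_⟩
      have e := H u v huv
      have hd' : ‖f - g‖ < ε / 3 := by rwa [← dist_eq_norm, dist_comm]
      have : Φ u f - Φ v f = Φ u (f - g) + (Φ u g - Φ v g) - Φ v (f - g) := by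
        rw [map_sub, map_sub]; abel
      rw [this]
      refine (norm_sub_le _ _).trans_lt ?_
      have := norm_add_le (Φ u (f - g)) (Φ u g - Φ v g)
      linarith [hΦn u (f - g), hΦn v (f - g)]
  obtain ⟨δ, hδ, H⟩ := key ⟨_, hf.domRestrict⟩ ε hε
  refine ⟨δ, hδ, fun u hu v hv huv => ?_⟩
  have hc : ∀ u : unitary A, cfc f (u : A) = Φ u ⟨_, hf.domRestrict⟩ := fun u => by
    rw [cfc_apply f (u : A) (hn u) (hf.mono (hs u))]
    rfl
  have := H ⟨u, hu⟩ ⟨v, hv⟩ huv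
  rwa [← hc, ← hc] at this

/-! ### Functions on the circle collapsing finite sets into roots of unity -/

/-- The function rising linearly from `0` to `1` on the `j`-th of `M` equal parts of `[0, π]`. -/
noncomputable def cellRamp (M j : ℕ) (θ : ℝ) : ℝ := max 0 (min 1 (θ * M / Real.pi - j))

/-- The self-map of `[0, π]` which is constant on the cells in `S` and stretched on the cell `f`. -/
noncomputable def collapseAngle (M : ℕ) (S : Finset ℕ) (f : ℕ) (θ : ℝ) : ℝ :=
  θ + Real.pi / M * (S.card * cellRamp M f θ - ∑ j ∈ S, cellRamp M j θ)

/-- The self-map of the circle, symmetric under conjugation, given by `collapseAngle`. -/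
noncomputable def collapseMap (M : ℕ) (S : Finset ℕ) (f : ℕ) (z : ℂ) : ℂ :=
  if 0 ≤ z.im then Complex.exp (Complex.I * (collapseAngle M S f (Real.arccos z.re) : ℝ))
  else Complex.exp (Complex.I * (-collapseAngle M S f (Real.arccos z.re) : ℝ))

theorem continuous_collapseAngle (M : ℕ) (S : Finset ℕ) (f : ℕ) :
    Continuous (collapseAngle M S f) := by
  unfold collapseAngle cellRamp
  fun_prop

theorem cellRamp_mem (M j : ℕ) (θ : ℝ) : cellRamp M j θ ∈ Set.Icc (0 : ℝ) 1 :=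
  ⟨le_max_left _ _, max_le zero_le_one (min_le_left _ _)⟩

theorem collapseAngle_zero (M : ℕ) (S : Finset ℕ) (f : ℕ) : collapseAngle M S f 0 = 0 := by
  have h : ∀ j, cellRamp M j 0 = 0 := fun j => by
    have : (0 : ℝ) * M / Real.pi - j ≤ 0 := by simp
    exact max_eq_left ((min_le_right _ _).trans this)
  simp [collapseAngle, h]

/-- The stretch by `S.card` cells on the cell `f` makes up exactly for the collapsed cells. -/
theorem collapseAngle_pi {M : ℕ} {S : Finset ℕ} {f : ℕ} (hS : ∀ j ∈ S, j < M) (hf : f < M) :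
    collapseAngle M S f Real.pi = Real.pi := by
  have h : ∀ j, j < M → cellRamp M j Real.pi = 1 := fun j hj => by
    have h1 : (1 : ℝ) ≤ Real.pi * M / Real.pi - j := by
      rw [mul_div_assoc, mul_div_cancel₀ _ Real.pi_ne_zero, le_sub_iff_add_le]
      exact_mod_cast (by omega : 1 + j ≤ M)
    rw [cellRamp, min_eq_left h1, max_eq_right zero_le_one]
  rw [collapseAngle, h f hf, Finset.sum_congr rfl fun j hj => h j (hS j hj)]
  simp

theorem abs_collapseAngle_sub_le (M : ℕ) (S : Finset ℕ) (f : ℕ) (θ : ℝ) :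
    |collapseAngle M S f θ - θ| ≤ Real.pi / M * S.card := by
  have h1 := cellRamp_mem M f θ
  have h2 : 0 ≤ ∑ j ∈ S, cellRamp M j θ := Finset.sum_nonneg fun j _ => (cellRamp_mem M j θ).1
  have h3 : ∑ j ∈ S, cellRamp M j θ ≤ S.card := by
    simpa using Finset.sum_le_card_nsmul S _ 1 fun j _ => (cellRamp_mem M j θ).2
  have h4 : (0 : ℝ) ≤ S.card := Nat.cast_nonneg _
  rw [collapseAngle, add_sub_cancel_left, abs_mul, abs_of_nonneg (by positivity)]
  refine mul_le_mul_of_nonneg_left ?_ (by positivity)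
  rw [abs_le]
  constructor <;> nlinarith [h1.1, h1.2]

theorem cellRamp_of_ne {M j k : ℕ} {θ : ℝ} (hk : (k : ℝ) ≤ θ * M / Real.pi)
    (hk' : θ * M / Real.pi ≤ k + 1) (hjk : j ≠ k) :
    cellRamp M j θ = if j < k then 1 else 0 := by
  split_ifs with h
  · have h1 : (j : ℝ) + 1 ≤ k := by exact_mod_cast h
    rw [cellRamp, min_eq_left (by linarith), max_eq_right zero_le_one]
  · have h1 : (k : ℝ) + 1 ≤ j := by exact_mod_cast (by omega : k + 1 ≤ j)
    exact max_eq_left ((min_le_right _ _).trans (by linarith))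

/-- On a cell `k ∈ S` the ramp of `k` cancels the growth of `θ`, while every other ramp is `0` or
`1`. -/
theorem exists_collapseAngle_eq {M : ℕ} (hM : 0 < M) {S : Finset ℕ} {f k : ℕ} {θ : ℝ}
    (hk : (k : ℝ) ≤ θ * M / Real.pi) (hk' : θ * M / Real.pi ≤ k + 1) (hkS : k ∈ S) (hfS : f ∉ S) :
    ∃ n : ℤ, collapseAngle M S f θ = Real.pi / M * n := by
  have hfk : f ≠ k := fun h => hfS (h ▸ hkS)
  have h1 := cellRamp_of_ne hk hk' hfk
  have h2 : cellRamp M k θ = θ * M / Real.pi - k := by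
    rw [cellRamp, min_eq_right (by linarith), max_eq_right (by linarith)]
  have h3 : ∑ j ∈ S.erase k, cellRamp M j θ = ∑ j ∈ S.erase k, if j < k then (1 : ℝ) else 0 :=
    Finset.sum_congr rfl fun j hj => cellRamp_of_ne hk hk' (Finset.ne_of_mem_erase hj)
  refine ⟨S.card * (if f < k then 1 else 0) + k - ∑ j ∈ S.erase k, if j < k then 1 else 0, ?_⟩
  have hM' : (M : ℝ) ≠ 0 := by exact_mod_cast hM.ne'
  rw [collapseAngle, ← Finset.add_sum_erase S _ hkS, h1, h2, h3]
  push_cast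
  field_simp
  ring

theorem exp_arccos_re {z : ℂ} (hz : ‖z‖ = 1) (h : 0 ≤ z.im) :
    Complex.exp (Complex.I * (Real.arccos z.re : ℝ)) = z := by
  have h1 : z.re ^ 2 + z.im ^ 2 = 1 := by
    have := Complex.sq_norm z
    rw [hz, Complex.normSq_apply] at this
    nlinarith
  have h2 : Real.sin (Real.arccos z.re) = z.im := by
    rw [Real.sin_arccos, ← h1, add_sub_cancel_left, Real.sqrt_sq h]
  have h3 : Real.cos (Real.arccos z.re) = z.re :=
    Real.cos_arccos (by nlinarith) (by nlinarith)
  rw [mul_comm, Complex.exp_mul_I, ← Complex.ofReal_cos, ← Complex.ofReal_sin, h2, h3,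
    Complex.re_add_im]

theorem norm_exp_I_mul_sub_le (x y : ℝ) :
    ‖Complex.exp (Complex.I * x) - Complex.exp (Complex.I * y)‖ ≤ |x - y| := by
  have h : Complex.exp (Complex.I * x) - Complex.exp (Complex.I * y) =
      Complex.exp (Complex.I * y) * (Complex.exp (Complex.I * (x - y : ℝ)) - 1) := by
    rw [mul_sub, ← Complex.exp_add, mul_one]
    congr 2; push_cast; ring
  rw [h, norm_mul, Complex.norm_exp_I_mul_ofReal, one_mul]
  exact Real.norm_exp_I_mul_ofReal_sub_one_le

section collapseMap

variable {M : ℕ} {S : Finset ℕ} {f : ℕ}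

theorem norm_collapseMap (z : ℂ) : ‖collapseMap M S f z‖ = 1 := by
  unfold collapseMap
  split_ifs <;> exact Complex.norm_exp_I_mul_ofReal _

/-- At `z = 1` and `z = -1` both branches of `collapseMap` agree, which gives continuity across the
real axis. -/
theorem exp_collapseAngle_of_im_eq_zero (hS : ∀ j ∈ S, j < M) (hf : f < M)
    {z : ℂ} (hz : ‖z‖ = 1) (h : z.im = 0) :
    Complex.exp (Complex.I * (collapseAngle M S f (Real.arccos z.re) : ℝ)) = z ∧
    Complex.exp (Complex.I * (-collapseAngle M S f (Real.arccos z.re) : ℝ)) = z := by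
  have h1 : z = z.re := Complex.ext rfl (by simp [h])
  have h2 : |z.re| = 1 := by rw [h1, Complex.norm_real] at hz; exact hz
  rcases (abs_eq zero_le_one).mp h2 with h3 | h3
  · rw [h1, Complex.ofReal_re, h3, Real.arccos_one, collapseAngle_zero]; simp
  · rw [h1, Complex.ofReal_re, h3, Real.arccos_neg_one, collapseAngle_pi hS hf]
    constructor
    · rw [mul_comm, Complex.exp_pi_mul_I]; simp
    · rw [mul_comm]; push_cast; rw [neg_mul, Complex.exp_neg, Complex.exp_pi_mul_I]; norm_num

theorem collapseMap_one (hS : ∀ j ∈ S, j < M) (hf : f < M) :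
    collapseMap M S f 1 = 1 := by
  have := (exp_collapseAngle_of_im_eq_zero hS hf (z := 1) (by simp) (by simp)).1
  rwa [collapseMap, if_pos (by simp)]

theorem collapseMap_conj (hS : ∀ j ∈ S, j < M) (hf : f < M)
    {z : ℂ} (hz : ‖z‖ = 1) :
    collapseMap M S f (star z) = star (collapseMap M S f z) := by
  have hexp : ∀ x : ℝ, star (Complex.exp (Complex.I * x)) = Complex.exp (Complex.I * (-x : ℝ)) := by
    intro x
    rw [Complex.star_def, ← Complex.exp_conj]; simp
  rcases lt_trichotomy z.im 0 with h | h | h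
  · rw [collapseMap, collapseMap, if_pos (by simpa using h.le), if_neg (not_le.mpr h), hexp]
    simp
  · have h1 : star z = z := Complex.conj_eq_iff_im.mpr h
    rw [h1, collapseMap, if_pos h.ge, (exp_collapseAngle_of_im_eq_zero hS hf hz h).1, h1]
  · rw [collapseMap, collapseMap, if_neg (by simpa using h), if_pos h.le, hexp]
    simp

theorem continuousOn_collapseMap (hS : ∀ j ∈ S, j < M) (hf : f < M) :
    ContinuousOn (collapseMap M S f) (Metric.sphere 0 1) := by
  rw [continuousOn_iff_continuous_domRestrict]
  have hc := continuous_collapseAngle M S f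
  have hre : Continuous fun z : Metric.sphere (0 : ℂ) 1 => collapseAngle M S f (Real.arccos (z : ℂ).re) :=
    hc.comp (Real.continuous_arccos.comp (Complex.continuous_re.comp continuous_subtype_val))
  refine Continuous.if_le ?_ ?_ continuous_const
    (Complex.continuous_im.comp continuous_subtype_val) ?_
  · fun_prop
  · fun_prop
  · intro z hz
    have := exp_collapseAngle_of_im_eq_zero hS hf (z := (z : ℂ)) (by simp) hz.symm
    rw [this.1, this.2]

theorem norm_collapseMap_sub_le {z : ℂ} (hz : ‖z‖ = 1) :
    ‖collapseMap M S f z - z‖ ≤ Real.pi / M * S.card := by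
  refine le_trans ?_ (abs_collapseAngle_sub_le M S f (Real.arccos z.re))
  by_cases h : 0 ≤ z.im
  · rw [collapseMap, if_pos h]
    nth_rewrite 2 [← exp_arccos_re hz h]
    exact norm_exp_I_mul_sub_le _ _
  · rw [collapseMap, if_neg h]
    have h1 : Complex.exp (Complex.I * (-Real.arccos z.re : ℝ)) = z := by
      have h2 := exp_arccos_re (z := star z) (by simp [hz]) (by simpa using (not_le.mp h).le)
      have h3 := congrArg star h2
      rw [star_star, Complex.star_def, ← Complex.exp_conj] at h3
      simpa using h3
    nth_rewrite 2 [← h1]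
    refine (norm_exp_I_mul_sub_le _ _).trans_eq ?_
    rw [← abs_neg]; congr 1; ring

end collapseMap

/-- The properties of a function on the circle by which eigenvalues are collapsed. -/
structure IsCollapse (ε : ℝ) (h : ℂ → ℂ) : Prop where
  continuousOn : ContinuousOn h (Metric.sphere 0 1)
  map_one : h 1 = 1
  norm_eq : ∀ z, h z * star (h z) = 1
  map_star : ∀ z, ‖z‖ = 1 → h (star z) = star (h z)
  norm_sub_le : ∀ z, ‖z‖ = 1 → ‖h z - z‖ ≤ ε

theorem exists_collapse {ε : ℝ} (hε : 0 < ε) (N : ℕ) :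
    ∃ m : ℕ, 0 < m ∧ ∃ H : Set (ℂ → ℂ), H.Finite ∧ (∀ h ∈ H, IsCollapse ε h) ∧
      ∀ T : Set ℂ, T ⊆ Metric.sphere 0 1 → T.Finite → T.ncard ≤ N →
        ∃ h ∈ H, ∀ z ∈ T, h z ^ m = 1 := by
  classical
  obtain ⟨M₀, hM₀⟩ := exists_nat_ge (Real.pi * N / ε)
  -- `M ≥ πN / ε` bounds the displacement by `ε`; `M > N` leaves a cell free of points of `T`, to
  -- serve as the stretched cell. The values on `T` are `exp (iπn / M)`, hence the exponent `2 * M`.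
  set M := M₀ + N + 1 with hM
  have hMpos : 0 < M := by omega
  have hMR : (0 : ℝ) < M := by exact_mod_cast hMpos
  refine ⟨2 * M, by omega, (fun p : Finset ℕ × ℕ => collapseMap M p.1 p.2) ''
    {p | p.1 ⊆ Finset.range M ∧ p.1.card ≤ N ∧ p.2 < M}, ?_, ?_, ?_⟩
  · refine Set.Finite.image _ (Set.Finite.subset
      (((Finset.range M).powerset ×ˢ Finset.range M).finite_toSet) ?_)
    rintro ⟨S, f⟩ ⟨h1, -, h3⟩
    exact Finset.mem_product.mpr ⟨Finset.mem_powerset.mpr h1, Finset.mem_range.mpr h3⟩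
  · rintro _ ⟨⟨S, f⟩, ⟨h1, h2, h3⟩, rfl⟩
    have hS : ∀ j ∈ S, j < M := fun j hj => Finset.mem_range.mp (h1 hj)
    refine ⟨continuousOn_collapseMap hS h3, collapseMap_one hS h3, fun z => ?_,
      fun z hz => collapseMap_conj hS h3 hz, fun z hz => (norm_collapseMap_sub_le hz).trans ?_⟩
    · rw [Complex.star_def, Complex.mul_conj, Complex.normSq_eq_norm_sq, norm_collapseMap]; simp
    · rw [div_mul_eq_mul_div, div_le_iff₀ hMR]
      rw [div_le_iff₀ hε] at hM₀
      have e1 : (S.card : ℝ) ≤ N := by exact_mod_cast h2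
      have e2 : (M₀ : ℝ) ≤ M := by exact_mod_cast (by omega : M₀ ≤ M)
      nlinarith [Real.pi_pos]
  · intro T hT hfin hcard
    set x : ℂ → ℝ := fun z => Real.arccos z.re * M / Real.pi with hx
    -- The minimum puts the angle `π` into the last cell.
    set cell : ℂ → ℕ := fun z => min ⌊x z⌋₊ (M - 1) with hcell
    have hx0 : ∀ z, 0 ≤ x z := fun z => by
      have := Real.arccos_nonneg z.re
      have := Real.pi_pos
      positivity
    have hxM : ∀ z, x z ≤ M := fun z => by
      rw [hx, div_le_iff₀ Real.pi_pos, mul_comm]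
      exact mul_le_mul_of_nonneg_left (Real.arccos_le_pi _) hMR.le
    have hc1 : ∀ z, (cell z : ℝ) ≤ x z := fun z =>
      (Nat.cast_le.mpr (min_le_left _ _)).trans (Nat.floor_le (hx0 z))
    have hc2 : ∀ z, x z ≤ cell z + 1 := fun z => by
      rcases le_total ⌊x z⌋₊ (M - 1) with h | h
      · rw [hcell]; simp only [min_eq_left h]; exact (Nat.lt_floor_add_one _).le
      · rw [hcell]; simp only [min_eq_right h]
        refine (hxM z).trans ?_
        exact_mod_cast (by omega : M ≤ M - 1 + 1)
    set S := hfin.toFinset.image cell with hSdef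
    have hScard : S.card ≤ N := Finset.card_image_le.trans
      ((Set.ncard_eq_toFinset_card T hfin) ▸ hcard)
    have hSM : S ⊆ Finset.range M := fun j hj => by
      obtain ⟨z, -, rfl⟩ := Finset.mem_image.mp hj
      exact Finset.mem_range.mpr (by simp only [hcell]; omega)
    obtain ⟨f, hfM, hfS⟩ : ∃ f ∈ Finset.range M, f ∉ S := by
      by_contra! hcon
      have := Finset.card_le_card hcon
      rw [Finset.card_range] at this
      omega
    refine ⟨_, ⟨(S, f), ⟨hSM, hScard, Finset.mem_range.mp hfM⟩, rfl⟩, fun z hz => ?_⟩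
    have hzS : cell z ∈ S := Finset.mem_image_of_mem _ (hfin.mem_toFinset.mpr hz)
    obtain ⟨n, hn⟩ := exists_collapseAngle_eq hMpos (hc1 z) (hc2 z) hzS hfS
    have hMC : (M : ℂ) ≠ 0 := by exact_mod_cast hMpos.ne'
    have hkey : ∀ k : ℤ, Complex.exp (Complex.I * (Real.pi / M * k : ℝ)) ^ (2 * M) = 1 := by
      intro k
      rw [← Complex.exp_nat_mul, Complex.exp_eq_one_iff]
      refine ⟨k, ?_⟩
      push_cast
      field_simp
    simp only [collapseMap, hn]
    split_ifs
    · exact hkey n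
    · have := hkey (-n)
      push_cast at this ⊢
      rwa [mul_neg] at this


/-! ### The Cayley path, intertwiners and collapses in `U_∞` -/

theorem dist_one_eq (w : UInf) : dist w 1 = ‖opU w - 1‖ := dist_eq_norm_opU w 1

open Classical in
/-- The Cayley path in `U_∞`. -/
noncomputable def cayU (s : unitInterval) (w : UInf) : UInf :=
  if h : dist w 1 < 2 then
    mkU (cay s (opU w)) (cay_mem_unitary s.2 (opU_mem_unitary w) (dist_one_eq w ▸ h))
      (Fixes.cay s.2 (fixes_opU w) (dist_one_eq w ▸ h))
  else 1

theorem opU_cayU {s : unitInterval} {w : UInf} (h : dist w 1 < 2) :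
    opU (cayU s w) = cay s (opU w) := by
  rw [cayU, dif_pos h, opU_mkU]

theorem cayU_zero {w : UInf} (h : dist w 1 < 2) : cayU 0 w = 1 :=
  opU_injective ((opU_cayU h).trans (cay_zero (dist_one_eq w ▸ h)))

theorem cayU_one {w : UInf} (h : dist w 1 < 2) : cayU 1 w = w :=
  opU_injective ((opU_cayU h).trans (cay_one (dist_one_eq w ▸ h)))

theorem commute_opU {u v : UInf} (h : Commute u v) : Commute (opU u) (opU v) :=
  congrArg opU h.eq

/-- The default value `1` of `cayU` lets this, `cayU_conj` and `cayU_inv` hold without a norm bound.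
-/
theorem commute_cayU {u w : UInf} (hc : Commute u w) (s : unitInterval) : Commute u (cayU s w) := by
  by_cases h : dist w 1 < 2
  · refine opU_injective ?_
    rw [opU_mul, opU_mul, opU_cayU h]
    exact (commute_cay (commute_opU hc) s).eq
  · rw [cayU, dif_neg h]; exact Commute.one_right u

theorem dist_conj_one (g w : UInf) : dist (g * w * g⁻¹) 1 = dist w 1 := by
  rw [← dist_mul_right_UInf _ _ g, ← dist_mul_left_UInf g w]; simp

theorem cayU_conj (g w : UInf) (s : unitInterval) :
    cayU s (g * w * g⁻¹) = g * cayU s w * g⁻¹ := by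
  by_cases h : dist w 1 < 2
  · refine opU_injective ?_
    rw [opU_cayU ((dist_conj_one g w).trans_lt h), opU_mul (g * cayU s w), opU_mul g (cayU s w),
      opU_cayU h]
    exact cay_conj (star_mul_opU g) (opU_mul_star g) rfl s.2 (dist_one_eq w ▸ h)
  · rw [cayU, dif_neg (by rwa [dist_conj_one]), cayU, dif_neg h]; simp

theorem dist_inv_one (w : UInf) : dist w⁻¹ 1 = dist w 1 := by
  simpa using dist_inv_UInf w 1

theorem cayU_inv (w : UInf) (s : unitInterval) : cayU s w⁻¹ = (cayU s w)⁻¹ := by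
  by_cases h : dist w 1 < 2
  · refine opU_injective ?_
    rw [opU_cayU ((dist_inv_one w).trans_lt h), opU_inv, opU_inv, opU_cayU h, star_cay]
  · rw [cayU, dif_neg (by rwa [dist_inv_one]), cayU, dif_neg h]; simp

theorem dist_cayU_one_le {w : UInf} (h : dist w 1 ≤ 1) (s : unitInterval) :
    dist (cayU s w) 1 ≤ 2 * dist w 1 := by
  rw [dist_one_eq, opU_cayU (by linarith), dist_one_eq]
  exact norm_cay_sub_one_le s.2 (dist_one_eq w ▸ h)

theorem isEmbedding_opU : Topology.IsEmbedding opU :=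
  Topology.IsEmbedding.subtypeVal.comp Topology.IsEmbedding.subtypeVal

theorem continuous_cayU {Y : Type*} [TopologicalSpace Y] {s : Y → unitInterval} {w : Y → UInf}
    (hs : Continuous s) (hw : Continuous w) (h : ∀ y, dist (w y) 1 < 2) :
    Continuous fun y => cayU (s y) (w y) := by
  rw [isEmbedding_opU.continuous_iff]
  have : (opU ∘ fun y => cayU (s y) (w y)) =
      (fun p : ℝ × (Hil →L[ℂ] Hil) => cay p.1 p.2) ∘ fun y => ((s y : ℝ), opU (w y)) := by
    ext1 y; exact opU_cayU (h y)
  rw [this]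
  exact continuousOn_cay.comp_continuous
    ((continuous_subtype_val.comp hs).prodMk (continuous_opU.comp hw))
    fun y => ⟨(s y).2, dist_one_eq (w y) ▸ h y⟩

/-! ### Polar correction and averaging over a finite cyclic group. -/

theorem exists_pol {x : Hil →L[ℂ] Hil} (hx : Fixes x) (hx' : Fixes (star x)) {u : UInf}
    (h : ‖x - opU u‖ ≤ 1 / 4) : ∃ w : UInf, opU w = pol x ∧ dist w u ≤ 4 * ‖x - opU u‖ := by
  have hu : IsUnit x := isUnit_of_norm_sub_unitary_lt (opU_mem_unitary u) (by linarith)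
  refine ⟨mkU (pol x) (pol_mem_unitary hu) (hx.pol hx' hu), rfl, ?_⟩
  rw [dist_eq_norm_opU]
  exact norm_pol_sub_unitary_le (opU_mem_unitary u) h

/-- The map `x ↦ a' x a⁻¹` is an isometry which moves `c` by `dist (a' * c) (c * a)`; iterate it `k`
times. -/
theorem dist_pow_conj_le (a a' c : UInf) (k : ℕ) :
    dist (a' ^ k * c * (a ^ k)⁻¹) c ≤ k * dist (a' * c) (c * a) := by
  induction k with
  | zero => simp
  | succ k ih =>
    have h1 : a' ^ (k + 1) * c * (a ^ (k + 1))⁻¹ = a' * (a' ^ k * c * (a ^ k)⁻¹) * a⁻¹ := by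
      rw [pow_succ' a', pow_succ' a, mul_inv_rev]; group
    have h2 : dist (a' * (a' ^ k * c * (a ^ k)⁻¹) * a⁻¹) (a' * c * a⁻¹) =
        dist (a' ^ k * c * (a ^ k)⁻¹) c := by
      rw [dist_mul_right_UInf, dist_mul_left_UInf]
    have h3 : dist (a' * c * a⁻¹) c = dist (a' * c) (c * a) := by
      rw [← dist_mul_right_UInf _ _ a]; simp
    rw [h1]
    refine (dist_triangle _ (a' * c * a⁻¹) _).trans ?_
    rw [h2, h3]; push_cast; linarith

theorem norm_average_sub_le {E : Type*} [NormedAddCommGroup E] [NormedSpace ℂ E] {ι : Type*}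
    {s : Finset ι} (hs : s.Nonempty) {f : ι → E} {y : E} {C : ℝ}
    (h : ∀ i ∈ s, ‖f i - y‖ ≤ C) : ‖(s.card : ℂ)⁻¹ • ∑ i ∈ s, f i - y‖ ≤ C := by
  have hc : (s.card : ℂ) ≠ 0 := by exact_mod_cast hs.card_ne_zero
  have hR : (0 : ℝ) < s.card := by exact_mod_cast hs.card_pos
  have h1 : (s.card : ℂ)⁻¹ • ∑ i ∈ s, f i - y = (s.card : ℂ)⁻¹ • ∑ i ∈ s, (f i - y) := by
    rw [Finset.sum_sub_distrib, smul_sub, Finset.sum_const, ← Nat.cast_smul_eq_nsmul ℂ, smul_smul,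
      inv_mul_cancel₀ hc, one_smul]
  have h2 := norm_sum_le_of_le s h
  rw [Finset.sum_const, nsmul_eq_mul] at h2
  rw [h1, norm_smul, norm_inv, Complex.norm_natCast, inv_mul_le_iff₀ hR]
  exact h2

theorem sum_range_shift {E : Type*} [AddCommGroup E] {m : ℕ} {f : ℕ → E} (h : f m = f 0) :
    ∑ k ∈ Finset.range m, f (k + 1) = ∑ k ∈ Finset.range m, f k := by
  have h1 := Finset.sum_range_succ f m
  rw [Finset.sum_range_succ' f m, h] at h1
  exact add_right_cancel h1

theorem sum_range_sub {E : Type*} [AddCommGroup E] {m : ℕ} {f : ℕ → E} (h : f m = f 0) :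
    ∑ k ∈ Finset.range m, f (m - k) = ∑ k ∈ Finset.range m, f k := by
  rw [← sum_range_shift h, ← Finset.sum_range_reflect]
  refine Finset.sum_congr rfl fun k hk => ?_
  have := Finset.mem_range.mp hk
  congr 1; omega

/-- The term `a'^k c a^{-k}` of the averages below. -/
noncomputable def powConj (a a' c : UInf) (k : ℕ) : UInf := a' ^ k * c * (a ^ k)⁻¹

/-- The average of `a'^k c a^{-k}` over `k < m`. -/
noncomputable def avgConj (m : ℕ) (a a' c : UInf) : Hil →L[ℂ] Hil :=
  (m : ℂ)⁻¹ • ∑ k ∈ Finset.range m, opU (powConj a a' c k)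

theorem powConj_self {m : ℕ} {a a' : UInf} (c : UInf) (ha : a ^ m = 1) (ha' : a' ^ m = 1) :
    powConj a a' c m = powConj a a' c 0 := by
  simp [powConj, ha, ha']

theorem fixes_avgConj {m : ℕ} (hm : 0 < m) (a a' c : UInf) : Fixes (avgConj m a a' c) := by
  have := Fixes.average (Finset.nonempty_range_iff.mpr hm.ne')
    (f := fun k => opU (powConj a a' c k)) fun k _ => fixes_opU _
  rwa [Finset.card_range] at this

theorem fixes_star_avgConj {m : ℕ} (hm : 0 < m) (a a' c : UInf) :
    Fixes (star (avgConj m a a' c)) := by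
  have h : star (avgConj m a a' c) =
      (m : ℂ)⁻¹ • ∑ k ∈ Finset.range m, opU (powConj a a' c k)⁻¹ := by
    rw [avgConj, star_smul, star_sum, star_inv₀, star_natCast]; rfl
  have := Fixes.average (Finset.nonempty_range_iff.mpr hm.ne')
    (f := fun k => opU (powConj a a' c k)⁻¹) fun k _ => fixes_opU _
  rwa [Finset.card_range, ← h] at this

/-- The terms are `m`-periodic in `k`, so the average is invariant under the shift `k ↦ k + 1`,
which is multiplication by `a'` on the left and `a⁻¹` on the right. -/
theorem avgConj_mul {m : ℕ} {a a' : UInf} (c : UInf) (ha : a ^ m = 1) (ha' : a' ^ m = 1) :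
    avgConj m a a' c * opU a = opU a' * avgConj m a a' c := by
  have h : ∀ k, powConj a a' c (k + 1) * a = a' * powConj a a' c k := fun k => by
    rw [powConj, powConj, pow_succ' a', pow_succ' a, mul_inv_rev]; group
  have hs := sum_range_shift (f := fun k => opU (powConj a a' c k)) (m := m)
    (congrArg opU (powConj_self c ha ha'))
  rw [avgConj, smul_mul_assoc, mul_smul_comm]
  conv_lhs => rw [← hs]
  rw [Finset.sum_mul, Finset.mul_sum]
  congr 1
  exact Finset.sum_congr rfl fun k _ => congrArg opU (h k)

/-- Conjugation by `b` inverts `a` and `a'`, so it exchanges the terms `k` and `m - k` of the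
average. -/
theorem commute_avgConj {m : ℕ} {a a' b c : UInf} (ha : a ^ m = 1) (ha' : a' ^ m = 1)
    (hb : b * a * b⁻¹ = a⁻¹) (hb' : b * a' * b⁻¹ = a'⁻¹) (hbc : Commute b c) :
    avgConj m a a' c * opU b = opU b * avgConj m a a' c := by
  have h : ∀ k ≤ m, powConj a a' c (m - k) * b = b * powConj a a' c k := fun k hkm => by
    have e1 : a' ^ (m - k) = (a' ^ k)⁻¹ := by
      rw [eq_inv_iff_mul_eq_one, ← pow_add, Nat.sub_add_cancel hkm, ha']
    have e2 : a ^ (m - k) = (a ^ k)⁻¹ := by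
      rw [eq_inv_iff_mul_eq_one, ← pow_add, Nat.sub_add_cancel hkm, ha]
    have e3 : b * a ^ k * b⁻¹ = (a ^ k)⁻¹ := by rw [← conj_pow, hb, inv_pow]
    have e4 : b * a' ^ k * b⁻¹ = (a' ^ k)⁻¹ := by rw [← conj_pow, hb', inv_pow]
    have e5 : b * (a ^ k)⁻¹ * b⁻¹ = a ^ k := by
      calc b * (a ^ k)⁻¹ * b⁻¹ = (b * a ^ k * b⁻¹)⁻¹ := by group
        _ = a ^ k := by rw [e3, inv_inv]
    rw [powConj, powConj, e1, e2]
    calc (a' ^ k)⁻¹ * c * (a ^ k)⁻¹⁻¹ * b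
        = b * a' ^ k * b⁻¹ * c * (b * (a ^ k)⁻¹ * b⁻¹) * b := by rw [inv_inv, e4, e5]
      _ = b * a' ^ k * b⁻¹ * (c * b) * (a ^ k)⁻¹ := by group
      _ = _ := by rw [← hbc.eq]; group
  have hs := sum_range_sub (f := fun k => opU (powConj a a' c k)) (m := m)
    (congrArg opU (powConj_self c ha ha'))
  rw [avgConj, smul_mul_assoc, mul_smul_comm]
  conv_lhs => rw [← hs]
  rw [Finset.sum_mul, Finset.mul_sum]
  congr 1
  exact Finset.sum_congr rfl fun k hk => congrArg opU (h k (Finset.mem_range.mp hk).le)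

theorem norm_avgConj_sub_le {m : ℕ} (hm : 0 < m) {a a' c : UInf} {η : ℝ}
    (hη : dist (a' * c) (c * a) ≤ η) : ‖avgConj m a a' c - opU c‖ ≤ m * η := by
  have := norm_average_sub_le (Finset.nonempty_range_iff.mpr hm.ne')
    (f := fun k => opU (powConj a a' c k)) (y := opU c) (C := m * η) ?_
  · rwa [Finset.card_range] at this
  intro k hk
  rw [← dist_eq_norm_opU]
  refine (dist_pow_conj_le a a' c k).trans ?_
  have hk' : (k : ℝ) ≤ m := by exact_mod_cast (Finset.mem_range.mp hk).le
  exact mul_le_mul hk' hη dist_nonneg (Nat.cast_nonneg m)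

/-- Averaging over powers turns an approximate intertwiner of two elements of finite order into an
exact one. -/
theorem exists_intertwiner {m : ℕ} (hm : 0 < m) {a a' c : UInf} (ha : a ^ m = 1) (ha' : a' ^ m = 1)
    {η : ℝ} (hη : dist (a' * c) (c * a) ≤ η) (hmη : m * η ≤ 1 / 4) :
    ∃ w : UInf, w * a = a' * w ∧ dist w c ≤ 4 * (m * η) ∧
      ∀ b : UInf, b * a * b⁻¹ = a⁻¹ → b * a' * b⁻¹ = a'⁻¹ → Commute b c → Commute b w := by
  have hclose := norm_avgConj_sub_le hm hη
  obtain ⟨w, hw, hwc⟩ := exists_pol (fixes_avgConj hm a a' c) (fixes_star_avgConj hm a a' c)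
    (hclose.trans hmη)
  refine ⟨w, opU_injective ?_, hwc.trans (by linarith), fun b hb hb' hbc => opU_injective ?_⟩
  · rw [opU_mul, opU_mul, hw]
    exact pol_mul (opU_mem_unitary a) (opU_mem_unitary a') (avgConj_mul c ha ha')
  · rw [opU_mul, opU_mul, hw]
    exact (pol_mul (opU_mem_unitary b) (opU_mem_unitary b) (commute_avgConj ha ha' hb hb' hbc)).symm

/-- This is `exists_intertwiner` with `m = 2` and `c = 1`, whence `1 / 8 = (1 / 4) / 2` and `8 = 4 *
2`. -/
theorem exists_conj_of_involutions {v v' : UInf} (hv : v * v = 1) (hv' : v' * v' = 1)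
    (h : dist v v' ≤ 1 / 8) : ∃ w : UInf, w * v * w⁻¹ = v' ∧ dist w 1 ≤ 8 * dist v v' := by
  obtain ⟨w, hw, hd, -⟩ := exists_intertwiner (m := 2) two_pos (a := v) (a' := v') (c := 1)
    (by rw [pow_two, hv]) (by rw [pow_two, hv']) (η := dist v v') (by simp [dist_comm])
    (by push_cast; linarith)
  refine ⟨w, by rw [hw]; group, by push_cast at hd; linarith⟩

theorem rk_eq_of_involutions {v v' : UInf} (hv : v * v = 1) (hv' : v' * v' = 1)
    (h : dist v v' ≤ 1 / 8) : rk v = rk v' := by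
  obtain ⟨w, hw, -⟩ := exists_conj_of_involutions hv hv' h
  have h1 := rk_conj w v
  have h2 := rk_conj w⁻¹ v'
  rw [hw] at h1
  rw [← hw] at h2
  have h3 : w⁻¹ * (w * v * w⁻¹) * w⁻¹⁻¹ = v := by group
  rw [h3, hw] at h2
  exact le_antisymm h2 h1

/-- The self-adjoint part of `u` is at distance `dist (u * u) 1 / 2` from `u`, and its unitary polar
part is again self-adjoint, hence an involution. -/
theorem exists_involution {u : UInf} (h : dist (u * u) 1 ≤ 1 / 2) :
    ∃ v : UInf, v * v = 1 ∧ dist v u ≤ 2 * dist (u * u) 1 := by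
  set x : Hil →L[ℂ] Hil := (2 : ℂ)⁻¹ • (opU u + star (opU u)) with hx
  have hsa : IsSelfAdjoint x := by
    rw [isSelfAdjoint_iff, hx, star_smul, star_add, star_star, add_comm]; simp
  have hfix : Fixes x := by
    have := Fixes.average (s := (Finset.univ : Finset Bool)) Finset.univ_nonempty
      (f := fun i => bif i then opU u else opU u⁻¹) (by rintro (_ | _) - <;> exact fixes_opU _)
    simpa [hx] using this
  have hclose : ‖x - opU u‖ = dist (u * u) 1 / 2 := by
    have h1 : x - opU u = (2 : ℂ)⁻¹ • (star (opU u) - opU u) := by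
      rw [hx]; module
    have h2 : dist (u * u) 1 = ‖star (opU u) - opU u‖ := by
      rw [← dist_mul_left_UInf u⁻¹, dist_comm, dist_eq_norm_opU]; simp
    rw [h1, h2, norm_smul]; simp; ring
  obtain ⟨v, hv, hd⟩ := exists_pol hfix (by rwa [hsa.star_eq]) (u := u) (by rw [hclose]; linarith)
  refine ⟨v, opU_injective ?_, by rw [hclose] at hd; linarith⟩
  have h1 : star (opU v) = opU v := by rw [hv]; exact pol_isSelfAdjoint hsa
  calc opU v * opU v = opU v * star (opU v) := by rw [h1]
    _ = 1 := opU_mul_star v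

/-- The image of an element of `U_∞` under a collapse. -/
theorem exists_collapseU {ε : ℝ} {h : ℂ → ℂ} (hh : IsCollapse ε h) (u : UInf) :
    ∃ v : UInf, opU v = cfc h (opU u) := by
  have hsp := Unitary.spectrum_subset_circle (𝕜 := ℂ) (u : unitary (Hil →L[ℂ] Hil))
  have hn : IsStarNormal (opU u) := isStarNormal_of_mem_unitary (opU_mem_unitary u)
  have hc : ContinuousOn h (spectrum ℂ (opU u)) := hh.continuousOn.mono hsp
  refine ⟨mkU (cfc h (opU u)) ?_ (fixes_cfc u hh.map_one), rfl⟩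
  rw [cfc_unitary_iff h (opU u)]
  intro z _
  rw [mul_comm]; exact hh.norm_eq z

/-- The image of an element of `U_∞` under a collapse. -/
noncomputable def collapseU {ε : ℝ} {h : ℂ → ℂ} (hh : IsCollapse ε h) (u : UInf) : UInf :=
  (exists_collapseU hh u).choose

section collapseU

variable {ε : ℝ} {h : ℂ → ℂ}

theorem opU_collapseU (hh : IsCollapse ε h) (u : UInf) : opU (collapseU hh u) = cfc h (opU u) :=
  (exists_collapseU hh u).choose_spec

theorem continuousOn_spectrum_opU (hh : IsCollapse ε h) (u : UInf) : ContinuousOn h (spectrum ℂ (opU u)) :=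
  hh.continuousOn.mono (Unitary.spectrum_subset_circle (u : unitary (Hil →L[ℂ] Hil)))

theorem isStarNormal_opU (u : UInf) : IsStarNormal (opU u) :=
  isStarNormal_of_mem_unitary (opU_mem_unitary u)

theorem norm_eq_one_of_mem_spectrum {u : UInf} {z : ℂ} (hz : z ∈ spectrum ℂ (opU u)) : ‖z‖ = 1 := by
  simpa using Unitary.spectrum_subset_circle (u : unitary (Hil →L[ℂ] Hil)) hz

theorem dist_collapseU_le (hh : IsCollapse ε h) (hε : 0 ≤ ε) (u : UInf) : dist (collapseU hh u) u ≤ ε := by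
  have hn := isStarNormal_opU u
  have hc := continuousOn_spectrum_opU hh u
  rw [dist_eq_norm_opU, opU_collapseU]
  have : cfc h (opU u) - opU u = cfc (fun z => h z - z) (opU u) := by
    rw [cfc_sub h (fun z => z) (opU u), cfc_id' ℂ (opU u)]
  rw [this]
  exact norm_cfc_le hε fun z hz => hh.norm_sub_le z (norm_eq_one_of_mem_spectrum hz)

theorem collapseU_conj (hh : IsCollapse ε h) (g u : UInf) :
    collapseU hh (g * u * g⁻¹) = g * collapseU hh u * g⁻¹ := by
  have hn := isStarNormal_opU u
  have hc := continuousOn_spectrum_opU hh u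
  refine opU_injective ?_
  have hφ : Continuous fun x : Hil →L[ℂ] Hil => opU g * x * star (opU g) := by fun_prop
  have := StarAlgHomClass.map_cfc (Unitary.conjStarAlgAut ℂ (Hil →L[ℂ] Hil) g) h (opU u) hc
    hφ hn (isStarNormal_opU (g * u * g⁻¹))
  simp only [Unitary.conjStarAlgAut_apply] at this
  rw [opU_mul, opU_mul, opU_collapseU, opU_collapseU]
  exact this.symm

theorem collapseU_inv (hh : IsCollapse ε h) (u : UInf) : collapseU hh u⁻¹ = (collapseU hh u)⁻¹ := by
  have hn := isStarNormal_opU u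
  have hc := continuousOn_spectrum_opU hh u
  refine opU_injective ?_
  rw [opU_inv, opU_collapseU, opU_collapseU, opU_inv, ← cfc_star, ← cfc_comp_star h (opU u) ?_ hn]
  · exact cfc_congr fun z hz => hh.map_star z (norm_eq_one_of_mem_spectrum hz)
  · exact hh.continuousOn.mono (by
      rintro _ ⟨z, hz, rfl⟩
      simpa using norm_eq_one_of_mem_spectrum hz)

theorem commute_collapseU (hh : IsCollapse ε h) {g u : UInf} (hc : Commute g u) : Commute g (collapseU hh u) := by
  have h1 := collapseU_conj hh g u
  rw [hc.eq, mul_inv_cancel_right] at h1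
  rw [commute_iff_eq]
  nth_rewrite 2 [h1]
  group

/-- This is what the symmetry of collapses under conjugation is for: collapsing `a` keeps the
relation with `b`. -/
theorem collapseU_conj_eq_inv (hh : IsCollapse ε h) {b u : UInf} (hb : b * u * b⁻¹ = u⁻¹) :
    b * collapseU hh u * b⁻¹ = (collapseU hh u)⁻¹ := by
  rw [← collapseU_conj, hb, collapseU_inv]

theorem collapseU_pow (hh : IsCollapse ε h) {u : UInf} {m : ℕ} (hm : ∀ z ∈ spectrum ℂ (opU u), h z ^ m = 1) :
    collapseU hh u ^ m = 1 := by
  have hn := isStarNormal_opU u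
  have hc := continuousOn_spectrum_opU hh u
  refine opU_injective ?_
  rw [opU_pow, opU_collapseU, ← cfc_pow h m (opU u), opU_one, ← cfc_const_one ℂ (opU u)]
  exact cfc_congr hm

theorem dist_collapseU_lt (hh : IsCollapse ε h) {η : ℝ} (hη : 0 < η) :
    ∃ δ > 0, ∀ u v : UInf, dist u v < δ → dist (collapseU hh u) (collapseU hh v) < η := by
  obtain ⟨δ, hδ, H⟩ := cfc_uniform_on_unitary (A := Hil →L[ℂ] Hil) hh.continuousOn hη
  refine ⟨δ, hδ, fun u v huv => ?_⟩
  rw [dist_eq_norm_opU, opU_collapseU, opU_collapseU]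
  exact H _ (opU_mem_unitary u) _ (opU_mem_unitary v) (by rwa [← dist_eq_norm_opU])

end collapseU


/-! ### Exact representations of `Γ` near approximate ones -/

/-- Triples of elements of `U_∞`. -/
abbrev Triple : Type := UInf × UInf × UInf

/-- The triples `(a, b, c)` which satisfy the relations of `Γ`. -/
def exactReps : Set Triple :=
  {p | Commute p.1 p.2.2 ∧ p.2.1 * p.2.1 = 1 ∧ p.2.1 * p.1 * p.2.1⁻¹ = p.1⁻¹}

theorem dist_conj_le (g u : UInf) : dist (g * u * g⁻¹) u ≤ 2 * dist g 1 := by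
  have h1 : dist (g * u * g⁻¹) u = dist (g * u) (u * g) := by
    rw [← dist_mul_right_UInf _ _ g]; simp
  have h2 : dist (g * u) u = dist g 1 := by simpa using dist_mul_right_UInf g 1 u
  have h3 : dist u (u * g) = dist g 1 := by
    rw [dist_comm]; simpa using dist_mul_left_UInf u g 1
  rw [h1]
  linarith [dist_triangle (g * u) u (u * g)]

theorem dist_conj_conj (g u v : UInf) : dist (g * u * g⁻¹) (g * v * g⁻¹) = dist u v := by
  rw [dist_mul_right_UInf, dist_mul_left_UInf]

/-- Simultaneous conjugation of a triple. -/
noncomputable def conjT (g : UInf) (p : Triple) : Triple := (g * p.1 * g⁻¹, g * p.2.1 * g⁻¹, g * p.2.2 * g⁻¹)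

theorem conjT_mem {p : Triple} (hp : p ∈ exactReps) (g : UInf) : conjT g p ∈ exactReps := by
  obtain ⟨h1, h2, h3⟩ := hp
  refine ⟨?_, ?_, ?_⟩
  · simp only [conjT]
    rw [commute_iff_eq]
    calc g * p.1 * g⁻¹ * (g * p.2.2 * g⁻¹) = g * (p.1 * p.2.2) * g⁻¹ := by group
      _ = _ := by rw [h1.eq]; group
  · simp only [conjT]
    calc g * p.2.1 * g⁻¹ * (g * p.2.1 * g⁻¹) = g * (p.2.1 * p.2.1) * g⁻¹ := by group
      _ = _ := by rw [h2]; group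
  · simp only [conjT]
    calc g * p.2.1 * g⁻¹ * (g * p.1 * g⁻¹) * (g * p.2.1 * g⁻¹)⁻¹
        = g * (p.2.1 * p.1 * p.2.1⁻¹) * g⁻¹ := by group
      _ = _ := by rw [h3]; group

theorem dist_triple_le {p q : Triple} {r : ℝ} (h1 : dist p.1 q.1 ≤ r) (h2 : dist p.2.1 q.2.1 ≤ r)
    (h3 : dist p.2.2 q.2.2 ≤ r) : dist p q ≤ r := by
  rw [Prod.dist_eq, Prod.dist_eq]
  exact max_le h1 (max_le h2 h3)

theorem dist_conjT_le (g : UInf) (p : Triple) : dist (conjT g p) p ≤ 2 * dist g 1 :=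
  dist_triple_le (dist_conj_le g _) (dist_conj_le g _) (dist_conj_le g _)

theorem joinedIn_of_continuous {X : Type*} [TopologicalSpace X] {F : Set X} {x y : X}
    {f : unitInterval → X} (hf : Continuous f) (h0 : f 0 = x) (h1 : f 1 = y) (h : ∀ s, f s ∈ F) :
    JoinedIn F x y :=
  ⟨⟨⟨f, hf⟩, h0, h1⟩, h⟩

theorem continuous_cayU_const {w : UInf} (h : dist w 1 ≤ 1) :
    Continuous fun s : unitInterval => cayU s w :=
  continuous_cayU continuous_id continuous_const fun _ => by linarith

theorem joinedIn_conjT {p : Triple} (hp : p ∈ exactReps) {w : UInf} {η : ℝ} (hw : dist w 1 ≤ η)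
    (hη : η ≤ 1) : JoinedIn (exactReps ∩ Metric.closedBall p (4 * η)) p (conjT w p) := by
  have hw1 : dist w 1 ≤ 1 := hw.trans hη
  have hc := continuous_cayU_const hw1
  refine joinedIn_of_continuous (f := fun s => conjT (cayU s w) p) ?_ ?_ ?_ fun s =>
    ⟨conjT_mem hp _, ?_⟩
  · unfold conjT; fun_prop
  · simp only [cayU_zero (by linarith : dist w 1 < 2)]; simp [conjT]
  · simp only [cayU_one (by linarith : dist w 1 < 2)]
  · rw [Metric.mem_closedBall]
    linarith [dist_conjT_le (cayU s w) p, dist_cayU_one_le hw1 s]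

/-- The element `w = a⁻¹ h(a)` commutes with `a` and `c` and is inverted by `b`. Its Cayley path
shares these properties, so `a * cayU s w` satisfies all relations. -/
theorem joinedIn_collapse {a b c : UInf} (hp : (a, b, c) ∈ exactReps) {ε : ℝ} {h : ℂ → ℂ}
    (hh : IsCollapse ε h) (hε : 0 ≤ ε) (hε1 : ε ≤ 1) :
    JoinedIn (exactReps ∩ Metric.closedBall (a, b, c) (2 * ε)) (a, b, c)
      (collapseU hh a, b, c) := by
  obtain ⟨h1, h2, h3⟩ := hp
  simp only at h1 h2 h3
  set w := a⁻¹ * collapseU hh a with hw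
  have hd : dist w 1 ≤ ε := by
    have := dist_mul_left_UInf a⁻¹ (collapseU hh a) a
    rw [inv_mul_cancel] at this
    rw [hw, this]; exact dist_collapseU_le hh hε a
  have hd1 : dist w 1 ≤ 1 := hd.trans hε1
  have hac : Commute a (collapseU hh a) := commute_collapseU hh (Commute.refl a)
  have haw : Commute a w := ((Commute.refl a).inv_right).mul_right hac
  have hcw : Commute c w := (h1.symm.inv_right).mul_right (commute_collapseU hh h1.symm)
  have hbw : b * w * b⁻¹ = w⁻¹ := by
    calc b * w * b⁻¹ = (b * a * b⁻¹)⁻¹ * (b * collapseU hh a * b⁻¹) := by rw [hw]; group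
      _ = a * (collapseU hh a)⁻¹ := by rw [h3, collapseU_conj_eq_inv hh h3, inv_inv]
      _ = (collapseU hh a)⁻¹ * a := hac.inv_right.eq
      _ = w⁻¹ := by rw [hw]; group
  have hc := continuous_cayU_const hd1
  refine joinedIn_of_continuous (f := fun s => (a * cayU s w, b, c)) (by fun_prop) ?_ ?_ fun s =>
    ⟨⟨?_, h2, ?_⟩, ?_⟩
  · simp only [cayU_zero (by linarith : dist w 1 < 2), mul_one]
  · simp only [cayU_one (by linarith : dist w 1 < 2)]; rw [hw, mul_inv_cancel_left]
  · exact (h1.symm.mul_right (commute_cayU hcw s)).symm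
  · calc b * (a * cayU s w) * b⁻¹ = (b * a * b⁻¹) * (b * cayU s w * b⁻¹) := by group
      _ = a⁻¹ * (cayU s w)⁻¹ := by rw [h3, ← cayU_conj, hbw, cayU_inv]
      _ = (cayU s w)⁻¹ * a⁻¹ := ((commute_cayU haw s).inv_inv).eq
      _ = _ := (mul_inv_rev _ _).symm
  · rw [Metric.mem_closedBall]
    have e : dist (a * cayU s w) a ≤ 2 * ε := by
      have := dist_mul_left_UInf a (cayU s w) 1
      rw [mul_one] at this
      rw [this]; linarith [dist_cayU_one_le hd1 s]
    exact dist_triple_le e (by simp; linarith) (by simp; linarith)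

/-- Only `a` constrains the third component, and `c⁻¹ c'` lies in its commutant together with its
Cayley path. -/
theorem joinedIn_third {a b c c' : UInf} (hp : (a, b, c) ∈ exactReps)
    (hp' : (a, b, c') ∈ exactReps) {η : ℝ} (hη : dist c c' ≤ η) (hη1 : η ≤ 1) :
    JoinedIn (exactReps ∩ Metric.closedBall (a, b, c) (2 * η)) (a, b, c) (a, b, c') := by
  obtain ⟨h1, h2, h3⟩ := hp
  have h1' := hp'.1
  simp only at h1 h2 h3 h1'
  have hη0 : 0 ≤ η := dist_nonneg.trans hη
  set w := c⁻¹ * c' with hw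
  have hd : dist w 1 ≤ η := by
    have := dist_mul_left_UInf c⁻¹ c' c
    rw [inv_mul_cancel] at this
    rw [hw, this, dist_comm]; exact hη
  have hd1 : dist w 1 ≤ 1 := hd.trans hη1
  have haw : Commute a w := h1.inv_right.mul_right h1'
  have hc := continuous_cayU_const hd1
  refine joinedIn_of_continuous (f := fun s => (a, b, c * cayU s w)) (by fun_prop) ?_ ?_ fun s =>
    ⟨⟨h1.mul_right (commute_cayU haw s), h2, h3⟩, ?_⟩
  · simp only [cayU_zero (by linarith : dist w 1 < 2), mul_one]
  · simp only [cayU_one (by linarith : dist w 1 < 2)]; rw [hw, mul_inv_cancel_left]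
  · rw [Metric.mem_closedBall]
    have e : dist (c * cayU s w) c ≤ 2 * η := by
      have := dist_mul_left_UInf c (cayU s w) 1
      rw [mul_one] at this
      rw [this]; linarith [dist_cayU_one_le hd1 s]
    exact dist_triple_le (by simp; linarith) (by simp; linarith) e

theorem JoinedIn.mono_closedBall {X : Type*} [PseudoMetricSpace X] {E : Set X} {x y p q : X}
    {r R : ℝ} (h : JoinedIn (E ∩ Metric.closedBall q r) x y) (hd : r + dist q p ≤ R) :
    JoinedIn (E ∩ Metric.closedBall p R) x y :=
  h.mono (Set.inter_subset_inter_right _ (Metric.closedBall_subset_closedBall' hd))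

/-- A common modulus for the collapses used on triples with bounded spectrum. -/
theorem exists_collapse_modulus {ε : ℝ} (hε : 0 < ε) (N : ℕ) :
    ∃ m : ℕ, 0 < m ∧ ∀ η > 0, ∃ δ > 0, ∀ a a' : UInf, rk a ≤ N → rk a' ≤ N →
      ∃ h : ℂ → ℂ, ∃ hh : IsCollapse ε h, collapseU hh a ^ m = 1 ∧ collapseU hh a' ^ m = 1 ∧
        ∀ u v : UInf, dist u v < δ → dist (collapseU hh u) (collapseU hh v) < η := by
  -- One collapse must serve `a` and `a'` at once, each having at most `N + 1` spectral points.
  -- Finiteness of `H` then gives a common `δ`.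
  obtain ⟨m, hm, H, hfin, hH, hT⟩ := exists_collapse hε (2 * (N + 1))
  refine ⟨m, hm, fun η hη => ?_⟩
  have hex : ∀ h ∈ H, ∀ᶠ δ in 𝓝[>] (0 : ℝ), ∀ hh : IsCollapse ε h, ∀ u v : UInf,
      dist u v < δ → dist (collapseU hh u) (collapseU hh v) < η := by
    intro h hhH
    obtain ⟨δ, hδ, hD⟩ := dist_collapseU_lt (hH h hhH) hη
    filter_upwards [Ioo_mem_nhdsGT hδ] with δ' hδ' hh u v huv
    exact hD u v (huv.trans hδ'.2)
  obtain ⟨δ, hD, hδ⟩ := (((Set.Finite.eventually_all hfin).mpr hex).and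
    self_mem_nhdsWithin).exists
  refine ⟨δ, hδ, fun a a' ha ha' => ?_⟩
  obtain ⟨f1, c1⟩ := spectrum_finite_and_ncard_le a
  obtain ⟨f2, c2⟩ := spectrum_finite_and_ncard_le a'
  obtain ⟨h, hhH, hz⟩ := hT (spectrum ℂ (opU a) ∪ spectrum ℂ (opU a'))
    (Set.union_subset (Unitary.spectrum_subset_circle (a : unitary (Hil →L[ℂ] Hil)))
      (Unitary.spectrum_subset_circle (a' : unitary (Hil →L[ℂ] Hil)))) (f1.union f2)
    ((Set.ncard_union_le _ _).trans (by omega))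
  exact ⟨h, hH h hhH, collapseU_pow _ fun z hz' => hz z (Or.inl hz'),
    collapseU_pow _ fun z hz' => hz z (Or.inr hz'), hD h hhH (hH h hhH)⟩

set_option maxHeartbeats 2000000 in
/-- The exact representations with bounded rank are uniformly locally path connected. -/
theorem exactReps_locally_joined {ε : ℝ} (hε : 0 < ε) (N : ℕ) :
    ∃ δ > 0, ∀ p ∈ exactReps, ∀ q ∈ exactReps, rk p.1 ≤ N → rk q.1 ≤ N → dist p q < δ →
      JoinedIn (exactReps ∩ Metric.closedBall p ε) p q := by
  set ε₁ : ℝ := min ε 1 / 8 with hε₁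
  have hε₁0 : 0 < ε₁ := by positivity
  have hε₁1 : ε₁ ≤ 1 / 8 := by rw [hε₁]; linarith [min_le_right ε 1]
  have hε₁ε : 8 * ε₁ ≤ ε := by rw [hε₁]; linarith [min_le_left ε 1]
  obtain ⟨m, hm, hmod⟩ := exists_collapse_modulus hε₁0 N
  have hmR : (0 : ℝ) < m := by exact_mod_cast hm
  -- Averaging multiplies errors by `m`, which is already fixed, so `η` is chosen with `m * η = ε₁ /
  -- 50`.
  set η : ℝ := ε₁ / 50 / m with hη
  have hη0 : 0 < η := by positivity
  have hmη : m * η = ε₁ / 50 := by rw [hη]; field_simp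
  obtain ⟨δ₀, hδ₀, hcol⟩ := hmod η hη0
  set δ : ℝ := min (δ₀ / 17) (ε₁ / 100) with hδ
  have hδ1 : 17 * δ ≤ δ₀ := by rw [hδ]; linarith [min_le_left (δ₀ / 17) (ε₁ / 100)]
  have hδ2 : δ ≤ ε₁ / 100 := min_le_right _ _
  refine ⟨δ, lt_min (by positivity) (by positivity), ?_⟩
  rintro ⟨a, b, c⟩ hp ⟨a', b', c'⟩ hq hrk hrk' hd
  rw [Prod.dist_eq, Prod.dist_eq, max_lt_iff, max_lt_iff] at hd
  obtain ⟨hda, hdb, hdc⟩ := hd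
  simp only at hda hdb hdc hrk hrk'
  -- The path has five legs: conjugate `b` to `b'`; collapse `a₁` to finite order; conjugate it to
  -- the collapse of `a'` by a unitary commuting with `b'`; move the third component to `c'` inside
  -- the commutant; undo the collapse of `a'`.
  obtain ⟨w, hw, hw1⟩ := exists_conj_of_involutions hp.2.1 hq.2.1
    (by simp only; linarith)
  simp only at hw hw1
  set a₁ := w * a * w⁻¹ with ha₁
  set c₁ := w * c * w⁻¹ with hc₁
  have hp1 : (a₁, b', c₁) ∈ exactReps := by
    have := conjT_mem hp w; simpa only [conjT, hw] using this
  have j1 : JoinedIn (exactReps ∩ Metric.closedBall (a, b, c) (4 * (8 * δ))) (a, b, c)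
      (a₁, b', c₁) := by
    have := joinedIn_conjT hp (w := w) (η := 8 * δ) (by linarith) (by linarith)
    simpa only [conjT, hw] using this
  have d1 : dist (a₁, b', c₁) (a, b, c) ≤ 16 * δ := by
    have := dist_conjT_le w (a, b, c)
    simp only [conjT, hw] at this
    linarith
  have hrk1 : rk a₁ ≤ N := (rk_conj w a).trans hrk
  -- Conjugation by `w` costs `2 * (8 * δ)`, and the distance from `a` to `a'` is below `δ`.
  have hda1 : dist a₁ a' < 17 * δ := by
    have := dist_triangle a₁ a a'
    linarith [dist_conj_le w a]
  have hdc1 : dist c₁ c' < 17 * δ := by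
    have := dist_triangle c₁ c c'
    linarith [dist_conj_le w c]
  obtain ⟨h, hh, hpow, hpow', hlip⟩ := hcol a₁ a' hrk1 hrk'
  have j2 := joinedIn_collapse hp1 hh hε₁0.le (by linarith)
  have j5 := joinedIn_collapse hq hh hε₁0.le (by linarith)
  have hp2 := (j2.target_mem).1
  have hq2 := (j5.target_mem).1
  have hd2 := hlip a₁ a' (hda1.trans_le hδ1)
  set a₂ := collapseU hh a₁ with ha₂
  set a₂' := collapseU hh a' with ha₂'
  obtain ⟨v, hv, hv1, hvb⟩ := exists_intertwiner hm (c := 1) hpow hpow' (η := η)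
    (by rw [mul_one, one_mul, dist_comm]; exact hd2.le) (by rw [hmη]; linarith)
  rw [hmη] at hv1
  have hvb' := hvb b' hp2.2.2 hq2.2.2 (Commute.one_right _)
  have hva : v * a₂ * v⁻¹ = a₂' := by rw [hv]; group
  have hvb'' : v * b' * v⁻¹ = b' := by rw [← hvb'.eq]; group
  set c₂ := v * c₁ * v⁻¹ with hc₂
  have j3 : JoinedIn (exactReps ∩ Metric.closedBall (a₂, b', c₁) (4 * (4 * (ε₁ / 50))))
      (a₂, b', c₁) (a₂', b', c₂) := by
    have := joinedIn_conjT hp2 (w := v) hv1 (by linarith)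
    simpa only [conjT, hva, hvb''] using this
  have hp3 := (j3.target_mem).1
  have d2 : dist (a₂, b', c₁) (a₁, b', c₁) ≤ ε₁ :=
    dist_triple_le (dist_collapseU_le hh hε₁0.le a₁) (by simp; linarith) (by simp; linarith)
  have d3 : dist (a₂', b', c₂) (a₂, b', c₁) ≤ 8 * (ε₁ / 50) := by
    have := dist_conjT_le v (a₂, b', c₁)
    simp only [conjT, hva, hvb''] at this
    linarith
  have hdc2 : dist c₂ c' ≤ 8 * (ε₁ / 50) + 17 * δ := by
    have := dist_triangle c₂ c₁ c'
    linarith [dist_conj_le v c₁]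
  have j4 := joinedIn_third hp3 hq2 hdc2 (by linarith)
  have d5 : dist (a', b', c') (a, b, c) ≤ δ := by
    rw [dist_comm]; exact dist_triple_le hda.le hdb.le hdc.le
  have t1 := dist_triangle (a₂, b', c₁) (a₁, b', c₁) (a, b, c)
  have t2 := dist_triangle (a₂', b', c₂) (a₂, b', c₁) (a, b, c)
  refine (JoinedIn.mono_closedBall j1 ?_).trans ((JoinedIn.mono_closedBall j2 ?_).trans
    ((JoinedIn.mono_closedBall j3 ?_).trans ((JoinedIn.mono_closedBall j4 ?_).trans
      (JoinedIn.mono_closedBall j5 ?_).symm)))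
  · rw [dist_self]; linarith
  · linarith
  · linarith
  · linarith
  · linarith

set_option maxHeartbeats 2000000 in
/-- An approximate representation of bounded rank is close to an exact one. -/
theorem exists_exactRep_near {ε : ℝ} (hε : 0 < ε) (N : ℕ) :
    ∃ δ > 0, ∀ a b c : UInf, dist (b * b) 1 < δ → dist (a * b * (a * b)) 1 < δ →
      dist (a * c) (c * a) < δ →
      (∀ v : UInf, v * v = 1 → dist v b ≤ 1 / 16 → rk v ≤ N) →
      (∀ v : UInf, v * v = 1 → dist v (a * b) ≤ 1 / 16 → rk v ≤ N) →
      ∃ p ∈ exactReps, rk p.1 ≤ 2 * N ∧ dist p (a, b, c) < ε := by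
  set ε₁ : ℝ := min ε 1 / 64 with hε₁
  have hε₁0 : 0 < ε₁ := by positivity
  have hε₁1 : ε₁ ≤ 1 / 64 := by rw [hε₁]; linarith [min_le_right ε 1]
  have hε₁ε : 64 * ε₁ ≤ ε := by rw [hε₁]; linarith [min_le_left ε 1]
  obtain ⟨m, hm, hmod⟩ := exists_collapse_modulus hε₁0 (2 * N)
  have hmR : (0 : ℝ) < m := by exact_mod_cast hm
  set η : ℝ := ε₁ / 4 / m with hη
  have hη0 : 0 < η := by positivity
  have hmη : m * η = ε₁ / 4 := by rw [hη]; field_simp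
  obtain ⟨δ₀, hδ₀, hcol⟩ := hmod η hη0
  set δ : ℝ := min (δ₀ / 20) (ε₁ / 100) with hδ
  have hδ1 : 20 * δ ≤ δ₀ := by rw [hδ]; linarith [min_le_left (δ₀ / 20) (ε₁ / 100)]
  have hδ2 : δ ≤ ε₁ / 100 := min_le_right _ _
  have hδ0 : 0 < δ := lt_min (by positivity) (by positivity)
  refine ⟨δ, hδ0, fun a b c hb hs hac hrb hrs => ?_⟩
  obtain ⟨b₁, hb₁, hdb⟩ := exists_involution (u := b) (by linarith)
  obtain ⟨s₁, hs₁, hds⟩ := exists_involution (u := a * b) (by linarith)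
  have rb := hrb b₁ hb₁ (by linarith)
  have rs := hrs s₁ hs₁ (by linarith)
  have hbi : b₁⁻¹ = b₁ := inv_eq_of_mul_eq_one_right hb₁
  have hsi : s₁⁻¹ = s₁ := inv_eq_of_mul_eq_one_right hs₁
  -- A product of two involutions is inverted by `b₁` automatically, and its rank is at most the sum
  -- of theirs.
  set a₀ := s₁ * b₁ with ha₀
  have hrk : rk a₀ ≤ 2 * N := (rk_mul_le s₁ b₁).trans (by omega)
  have hinv : b₁ * a₀ * b₁⁻¹ = a₀⁻¹ := by
    rw [ha₀, mul_inv_rev, hbi, hsi]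
    calc b₁ * (s₁ * b₁) * b₁ = b₁ * s₁ * (b₁ * b₁) := by group
      _ = _ := by rw [hb₁, mul_one]
  have hda : dist a₀ a ≤ 4 * δ := by
    have e1 : a = (a * b) * b⁻¹ := by group
    have e2 : dist b₁ b⁻¹ ≤ 2 * δ := by
      rw [← hbi, dist_inv_UInf]; linarith
    rw [e1, ha₀]
    refine (dist_mul_mul_le_UInf _ _ _ _).trans ?_
    linarith
  -- The collapse precedes the averaging: `h(a₀)` has finite order, and by the modulus of `h` it
  -- still almost commutes with `c`.
  obtain ⟨h, hh, hpow, -, hlip⟩ := hcol a₀ a₀ hrk hrk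
  have hcomm : dist (c * a₀ * c⁻¹) a₀ < δ₀ := by
    have e1 : dist (c * a₀ * c⁻¹) (c * a * c⁻¹) ≤ 4 * δ := by rw [dist_conj_conj]; exact hda
    have e2 : dist (c * a * c⁻¹) a < δ := by
      rw [← dist_mul_right_UInf _ _ c, inv_mul_cancel_right, dist_comm]; exact hac
    have := dist_triangle4 (c * a₀ * c⁻¹) (c * a * c⁻¹) a a₀
    rw [dist_comm a a₀] at this
    linarith
  have hd2 := hlip _ _ hcomm
  rw [collapseU_conj] at hd2
  set a₁ := collapseU hh a₀ with ha₁
  obtain ⟨c₁, hc₁, hdc, -⟩ := exists_intertwiner hm (c := c) hpow hpow (η := η)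
    (by rw [← dist_mul_right_UInf _ _ c, inv_mul_cancel_right, dist_comm] at hd2; exact hd2.le)
    (by rw [hmη]; linarith)
  rw [hmη] at hdc
  refine ⟨(a₁, b₁, c₁), ⟨hc₁.symm, hb₁, collapseU_conj_eq_inv hh hinv⟩, ?_, ?_⟩
  -- The rank of `a₁` is bounded by writing it as `(a₁ b₁) b₁`, where `a₁ b₁` is an involution near
  -- `a * b`.
  · have e1 : b₁ * a₁ * b₁⁻¹ = a₁⁻¹ := collapseU_conj_eq_inv hh hinv
    have e2 : a₁ * b₁ * (a₁ * b₁) = 1 := by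
      calc a₁ * b₁ * (a₁ * b₁) = a₁ * (b₁ * a₁ * b₁) := by group
        _ = a₁ * (b₁ * a₁ * b₁⁻¹) := by rw [hbi]
        _ = 1 := by rw [e1, mul_inv_cancel]
    have e3 : dist (a₁ * b₁) (a * b) ≤ 1 / 16 := by
      refine (dist_mul_mul_le_UInf _ _ _ _).trans ?_
      have := dist_triangle a₁ a₀ a
      linarith [dist_collapseU_le hh hε₁0.le a₀]
    have r1 := hrs _ e2 e3
    have e4 : a₁ = a₁ * b₁ * b₁ := by rw [mul_assoc, hb₁, mul_one]
    change rk a₁ ≤ 2 * N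
    rw [e4]
    exact (rk_mul_le _ _).trans (by omega)
  · refine (dist_triple_le (r := 63 * ε₁) ?_ ?_ ?_).trans_lt (by linarith)
    · have := dist_triangle a₁ a₀ a
      simp only
      linarith [dist_collapseU_le hh hε₁0.le a₀]
    · simp only; linarith
    · simp only; linarith


/-! ### Approximating a path by a path in a uniformly locally path connected set -/

/-- From `t n` one advances by a step depending only on `⌊t n⌋₊`. On a bounded range only finitely
many step lengths occur, so the partition cannot accumulate. -/
theorem exists_partition {X : Type*} [PseudoMetricSpace X] {σ : ℝ≥0 → X} (hσ : Continuous σ)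
    {ω : ℕ → ℝ} (hω : ∀ k, 0 < ω k) :
    ∃ t : ℕ → ℝ≥0, StrictMono t ∧ t 0 = 0 ∧ Tendsto t atTop atTop ∧
      ∀ n, ∀ s ∈ Set.Icc (t n) (t (n + 1)), dist (σ s) (σ (t n)) < ω ⌊t n⌋₊ := by
  -- From `t n < k + 1` a step of length at most `1` stays in `[0, k + 2]`, where `σ` is uniformly
  -- continuous.
  have hr : ∀ k : ℕ, ∃ r : ℝ≥0, 0 < r ∧ r ≤ 1 ∧ ∀ s ∈ Set.Icc (0 : ℝ≥0) (k + 2),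
      ∀ s' ∈ Set.Icc (0 : ℝ≥0) (k + 2), dist s s' ≤ r → dist (σ s) (σ s') < ω k := by
    intro k
    have huc := (isCompact_Icc (a := (0 : ℝ≥0)) (b := k + 2)).uniformContinuousOn_of_continuous
      hσ.continuousOn
    obtain ⟨r, hr, H⟩ := Metric.uniformContinuousOn_iff.mp huc (ω k) (hω k)
    lift r to ℝ≥0 using hr.le
    have hr' : 0 < r := by exact_mod_cast hr
    refine ⟨min 1 (r / 2), lt_min one_pos (half_pos hr'), min_le_left _ _,
      fun s hs s' hs' h => H s hs s' hs' (h.trans_lt ?_)⟩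
    exact_mod_cast (min_le_right _ _).trans_lt (half_lt_self hr')
  choose r hr0 hr1 hr using hr
  let t : ℕ → ℝ≥0 := fun n => Nat.rec 0 (fun _ x => x + r ⌊x⌋₊) n
  have hsucc : ∀ n, t (n + 1) = t n + r ⌊t n⌋₊ := fun n => rfl
  have hmono : StrictMono t := strictMono_nat_of_lt_succ fun n => by
    rw [hsucc]; exact lt_add_of_pos_right _ (hr0 _)
  refine ⟨t, hmono, rfl, ?_, ?_⟩
  · refine tendsto_atTop_atTop_of_monotone hmono.monotone fun b => ?_
    refine Classical.by_contradiction fun hcon => ?_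
    have hb : ∀ n, t n < b := fun n => not_le.mp fun h => hcon ⟨n, h⟩
    obtain ⟨K, hK⟩ := exists_nat_ge b
    have hfl : ∀ n, ⌊t n⌋₊ ∈ Finset.range (K + 1) := fun n => by
      rw [Finset.mem_range]
      have : ((⌊t n⌋₊ : ℕ) : ℝ≥0) ≤ K := (Nat.floor_le (zero_le)).trans ((hb n).le.trans hK)
      have : ⌊t n⌋₊ ≤ K := by exact_mod_cast this
      omega
    obtain ⟨k₀, -, hk₀⟩ := Finset.exists_min_image (Finset.range (K + 1)) r ⟨0, by simp⟩
    have hge : ∀ n : ℕ, n * r k₀ ≤ t n := by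
      intro n
      induction n with
      | zero => simp
      | succ n ih =>
        rw [hsucc]; push_cast; rw [add_mul, one_mul]
        exact add_le_add ih (hk₀ _ (hfl n))
    obtain ⟨n, hn⟩ := exists_nat_ge (b / r k₀)
    rw [div_le_iff₀ (hr0 k₀)] at hn
    exact absurd (hn.trans (hge n)) (not_le.mpr (hb n))
  · intro n s hs
    have h1 : t n ≤ (⌊t n⌋₊ : ℝ≥0) + 1 := (Nat.lt_floor_add_one (t n)).le
    have h2 : t (n + 1) ≤ (⌊t n⌋₊ : ℝ≥0) + 2 := by
      rw [hsucc]
      calc t n + r ⌊t n⌋₊ ≤ (⌊t n⌋₊ + 1) + 1 := add_le_add h1 (hr1 _)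
        _ = _ := by ring
    refine hr _ s ⟨zero_le, hs.2.trans h2⟩ _ ⟨zero_le, hmono.monotone n.le_succ |>.trans h2⟩ ?_
    rw [NNReal.dist_eq, abs_of_nonneg (sub_nonneg.mpr (NNReal.coe_le_coe.mpr hs.1))]
    have h3 : s ≤ t n + r ⌊t n⌋₊ := hsucc n ▸ hs.2
    have h3 := NNReal.coe_le_coe.mpr h3
    rw [NNReal.coe_add] at h3
    linarith

/-- Gluing countably many paths. -/
theorem exists_concatenation {X : Type*} [TopologicalSpace X] {t : ℕ → ℝ≥0} (ht : StrictMono t)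
    (ht0 : t 0 = 0) (htop : Tendsto t atTop atTop) {v : ℕ → X} (γ : ∀ n, Path (v n) (v (n + 1))) :
    ∃ τ : ℝ≥0 → X, Continuous τ ∧
      ∀ s, ∃ n, s ∈ Set.Icc (t n) (t (n + 1)) ∧ τ s ∈ Set.range (γ n) := by
  classical
  have hex : ∀ s : ℝ≥0, ∃ n, s < t (n + 1) := fun s => by
    obtain ⟨n, hn⟩ := (htop.eventually (eventually_gt_atTop s)).exists
    exact ⟨n, hn.trans (ht n.lt_succ_self)⟩
  let idx : ℝ≥0 → ℕ := fun s => Nat.find (hex s)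
  let g : ℕ → ℝ≥0 → X := fun n s => (γ n).extend (((s : ℝ) - t n) / (t (n + 1) - t n))
  have hg : ∀ n, Continuous (g n) := fun n => (γ n).continuous_extend.comp (by fun_prop)
  have hidx : ∀ n s, t n ≤ s → s < t (n + 1) → idx s = n := fun n s h1 h2 => by
    refine (Nat.find_eq_iff (hex s)).mpr ⟨h2, fun m hm => ?_⟩
    exact not_lt.mpr ((ht.monotone (Nat.succ_le_of_lt hm)).trans h1)
  have hlast : ∀ n, g n (t (n + 1)) = v (n + 1) := fun n => by
    have h : (0 : ℝ) < t (n + 1) - t n := sub_pos.mpr (NNReal.coe_lt_coe.mpr (ht n.lt_succ_self))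
    simp only [g]; rw [div_self h.ne', Path.extend_one]
  have hfirst : ∀ n, g n (t n) = v n := fun n => by simp [g]
  have hon : ∀ n, ∀ s ∈ Set.Icc (t n) (t (n + 1)), g (idx s) s = g n s := by
    intro n s hs
    rcases hs.2.lt_or_eq with h | h
    · rw [hidx n s hs.1 h]
    · rw [h, hidx (n + 1) (t (n + 1)) le_rfl (ht (n + 1).lt_succ_self), hlast, hfirst]
  have hidx1 : ∀ s, s < t (idx s + 1) := fun s => Nat.find_spec (hex s)
  have hidx0 : ∀ s, t (idx s) ≤ s := fun s => by
    rcases Nat.eq_zero_or_pos (idx s) with h | h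
    · rw [h, ht0]; exact zero_le
    · have h1 := Nat.find_min (hex s) (m := idx s - 1) (Nat.sub_lt h one_pos)
      rw [show idx s - 1 + 1 = idx s by omega] at h1
      exact not_lt.mp h1
  refine ⟨fun s => g (idx s) s, ?_, fun s => ⟨idx s, ⟨hidx0 s, (hidx1 s).le⟩, ?_⟩⟩
  · have hlf : LocallyFinite fun n => Set.Icc (t n) (t (n + 1)) := by
      intro x
      obtain ⟨m, hm⟩ := (htop.eventually (eventually_gt_atTop x)).exists
      refine ⟨Set.Iio (t m), Iio_mem_nhds hm, (Set.finite_Iio m).subset ?_⟩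
      rintro n ⟨y, hy1, hy2⟩
      exact ht.lt_iff_lt.mp (hy1.1.trans_lt hy2)
    refine hlf.continuous ?_ (fun n => isClosed_Icc) fun n =>
      (hg n).continuousOn.congr (hon n)
    exact Set.eq_univ_of_forall fun s => Set.mem_iUnion.mpr ⟨idx s, hidx0 s, (hidx1 s).le⟩
  · simp only [g]
    rw [← Path.extend_range]
    exact Set.mem_range_self _

/-- Choose points of `G` near `σ` at the times of a fine partition and join consecutive ones by
short paths in `E`. The joining paths may leave `G`; only their endpoints lie in it. The tolerance
is tightened slowly along the half-line. -/
theorem exists_asymptotic_path {X : Type*} [PseudoMetricSpace X] {E G : Set X} {σ : ℝ≥0 → X}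
    (hσ : Continuous σ)
    (hG : ∀ ε > 0, ∀ᶠ t in atTop, ∃ v ∈ G, dist v (σ t) < ε)
    (hE : ∀ ε > 0, ∃ δ > 0, ∀ p ∈ G, ∀ q ∈ G, dist p q < δ →
      JoinedIn (E ∩ Metric.closedBall p ε) p q) :
    ∃ (T : ℝ≥0) (τ : ℝ≥0 → X), Continuous τ ∧ (∀ t, τ t ∈ E) ∧
      Tendsto (fun t => dist (τ t) (σ (t + T))) atTop (𝓝 0) := by
  have hδ : ∀ j : ℕ, ∃ δ > 0, ∀ p ∈ G, ∀ q ∈ G, dist p q < δ →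
      JoinedIn (E ∩ Metric.closedBall p (1 / ((j : ℝ) + 1))) p q := fun j => hE _ (by positivity)
  choose δ₀ hδ₀ hjoin₀ using hδ
  -- Taking the minimum over all earlier indices makes `δ` antitone, so that neighbouring vertices
  -- of different levels can be compared; the cap `1 / (j + 1)` makes the approximation error
  -- vanish.
  set δ : ℕ → ℝ := fun j => min (1 / ((j : ℝ) + 1))
    ((Finset.range (j + 1)).inf' ⟨0, by simp⟩ δ₀) with hδdef
  have hδ : ∀ j, 0 < δ j := fun j => lt_min (by positivity)
    ((Finset.lt_inf'_iff _).mpr fun i _ => hδ₀ i)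
  have hδ1 : ∀ j, δ j ≤ 1 / ((j : ℝ) + 1) := fun j => min_le_left _ _
  have hδδ : ∀ j, δ j ≤ δ₀ j := fun j => (min_le_right _ _).trans (Finset.inf'_le _ (by simp))
  have hδanti : Antitone δ := fun i j hij => by
    refine min_le_min ?_ (Finset.inf'_mono _ (Finset.range_mono (by omega)) _)
    exact one_div_le_one_div_of_le (by positivity)
      (by have : (i : ℝ) ≤ j := by exact_mod_cast hij
          linarith)
  have hT : ∀ j : ℕ, ∃ T : ℕ, ∀ t : ℝ≥0, (T : ℝ≥0) ≤ t → ∃ v ∈ G, dist v (σ t) < δ j / 3 := by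
    intro j
    obtain ⟨T, hT⟩ := eventually_atTop.mp (hG (δ j / 3) (by have := hδ j; positivity))
    obtain ⟨n, hn⟩ := exists_nat_ge T
    exact ⟨n, fun t ht => hT t (hn.trans ht)⟩
  choose T hT using hT
  set T₀ : ℕ := T 0 with hT₀
  -- The level is the best tolerance already available at time `k + T₀`. The shift by `T₀ = T 0`
  -- makes level `0` admissible from the start.
  set level : ℕ → ℕ := fun k => Nat.findGreatest (fun j => T j ≤ k + T₀) k with hlevel
  have hlev : ∀ k, T (level k) ≤ k + T₀ := fun k =>
    Nat.findGreatest_spec (P := fun j => T j ≤ k + T₀) (Nat.zero_le k) (Nat.le_add_left _ _)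
  have hlevmono : Monotone level := fun k k' hk =>
    Nat.findGreatest_mono (fun j (hj : T j ≤ k + T₀) => hj.trans (by omega)) hk
  have hlevtop : ∀ j, level (max j (T j)) ≥ j := fun j =>
    Nat.le_findGreatest (le_max_left _ _) ((le_max_right _ _).trans (Nat.le_add_right _ _))
  set σ' : ℝ≥0 → X := fun t => σ (t + T₀) with hσ'
  have hσ'c : Continuous σ' := hσ.comp (by fun_prop)
  obtain ⟨t, ht, ht0, httop, hosc⟩ := exists_partition hσ'c (ω := fun k => δ (level k) / 3)
    fun k => by have := hδ (level k); positivity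
  have hv : ∀ n, ∃ v ∈ G, dist v (σ' (t n)) < δ (level ⌊t n⌋₊) / 3 := fun n => by
    refine hT _ _ ?_
    calc ((T (level ⌊t n⌋₊) : ℕ) : ℝ≥0) ≤ ((⌊t n⌋₊ + T₀ : ℕ) : ℝ≥0) := by exact_mod_cast hlev _
      _ ≤ t n + T₀ := by push_cast; gcongr; exact Nat.floor_le (zero_le)
  choose v hvG hvd using hv
  have hjoin : ∀ n, JoinedIn (E ∩ Metric.closedBall (v n) (1 / ((level ⌊t n⌋₊ : ℕ) + 1 : ℝ)))
      (v n) (v (n + 1)) := fun n => by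
    refine hjoin₀ _ _ (hvG n) _ (hvG (n + 1)) (lt_of_lt_of_le ?_ (hδδ _))
    have h1 := hvd n
    have h2 := hvd (n + 1)
    have h3 := hosc n (t (n + 1)) ⟨(ht n.lt_succ_self).le, le_rfl⟩
    have h4 : δ (level ⌊t (n + 1)⌋₊) ≤ δ (level ⌊t n⌋₊) :=
      hδanti (hlevmono (Nat.floor_mono (ht n.lt_succ_self).le))
    have h5 := dist_triangle4 (v n) (σ' (t n)) (σ' (t (n + 1))) (v (n + 1))
    rw [dist_comm (σ' (t n)) (σ' (t (n + 1))), dist_comm (σ' (t (n + 1))) (v (n + 1))] at h5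
    linarith
  obtain ⟨τ, hτ, hτr⟩ := exists_concatenation ht ht0 httop fun n => (hjoin n).somePath
  refine ⟨T₀, τ, hτ, fun s => ?_, ?_⟩
  · obtain ⟨n, -, r, hr⟩ := hτr s
    rw [← hr]; exact ((hjoin n).somePath_mem r).1
  · rw [Metric.tendsto_atTop]
    intro ε hε
    obtain ⟨j, hj⟩ := exists_nat_one_div_lt (by positivity : 0 < ε / 3)
    obtain ⟨n₀, hn₀⟩ := (httop.eventually (eventually_ge_atTop ((max j (T j) : ℕ) : ℝ≥0))).exists
    refine ⟨t (n₀ + 1), fun s hs => ?_⟩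
    obtain ⟨n, hn, r, hr⟩ := hτr s
    have hball := ((hjoin n).somePath_mem r).2
    rw [hr, Metric.mem_closedBall] at hball
    have hnn : n₀ ≤ n := by
      have := ht.le_iff_le.mp (hs.le.trans hn.2)
      omega
    have hlv : j ≤ level ⌊t n⌋₊ := (hlevtop j).le.trans (hlevmono
      (Nat.le_floor (hn₀.trans (ht.monotone hnn))))
    have e1 : 1 / ((level ⌊t n⌋₊ : ℕ) + 1 : ℝ) ≤ 1 / ((j : ℝ) + 1) :=
      one_div_le_one_div_of_le (by positivity)
        (by have : (j : ℝ) ≤ level ⌊t n⌋₊ := by exact_mod_cast hlv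
            linarith)
    have e2 := hδ1 (level ⌊t n⌋₊)
    have e3 := hosc n s hn
    have e4 := hvd n
    have e5 := dist_triangle4 (τ s) (v n) (σ' (t n)) (σ' s)
    rw [dist_comm (σ' (t n)) (σ' s)] at e5
    rw [Real.dist_eq, sub_zero, abs_of_nonneg dist_nonneg]
    change dist (τ s) (σ' s) < ε
    have := hδ (level ⌊t n⌋₊)
    linarith


/-! ### Homotopies of asymptotic representations -/

/-- The triple of the images of the generators. -/
def toTriple (u : Gen → UInf) : Triple := (u Gen.a, u Gen.b, u Gen.c)

/-- The family of generators given by a triple. -/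
def ofTriple (p : Triple) : Gen → UInf
  | Gen.a => p.1
  | Gen.b => p.2.1
  | Gen.c => p.2.2

theorem ofTriple_toTriple (u : Gen → UInf) : ofTriple (toTriple u) = u := by
  funext i; cases i <;> rfl

/-- The deviation of a triple. -/
noncomputable def dev (p : Triple) : ℝ := deviation relΓ (ofTriple p)

theorem dist_rel_zero (p : Triple) :
    ‖opU (FreeGroup.lift (ofTriple p) (relΓ 0)) - 1‖ = dist (p.1 * p.2.2) (p.2.2 * p.1) := by
  have : FreeGroup.lift (ofTriple p) (relΓ 0) = p.1 * p.2.2 * p.1⁻¹ * p.2.2⁻¹ := by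
    simp [relΓ, ofTriple]
  rw [this, ← dist_one_eq, ← dist_mul_right_UInf _ _ (p.2.2 * p.1)]
  rw [one_mul]
  congr 1
  group

theorem dist_rel_one (p : Triple) :
    ‖opU (FreeGroup.lift (ofTriple p) (relΓ 1)) - 1‖ = dist (p.2.1 * p.2.1) 1 := by
  have : FreeGroup.lift (ofTriple p) (relΓ 1) = p.2.1 * p.2.1 := by
    simp [relΓ, ofTriple, pow_two]
  rw [this, ← dist_one_eq]

theorem dist_rel_two (p : Triple) :
    ‖opU (FreeGroup.lift (ofTriple p) (relΓ 2)) - 1‖ =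
      dist (p.1 * p.2.1 * (p.1 * p.2.1)) 1 := by
  have : FreeGroup.lift (ofTriple p) (relΓ 2) = p.1 * p.2.1 * (p.1 * p.2.1) := by
    simp [relΓ, ofTriple, pow_two]
  rw [this, ← dist_one_eq]

theorem norm_rel_le_dev (p : Triple) (j : Fin 3) :
    ‖opU (FreeGroup.lift (ofTriple p) (relΓ j)) - 1‖ ≤ dev p :=
  le_ciSup (f := fun j => ‖opU (FreeGroup.lift (ofTriple p) (relΓ j)) - 1‖)
    (Set.finite_range _).bddAbove j

theorem dev_nonneg (p : Triple) : 0 ≤ dev p := (norm_nonneg _).trans (norm_rel_le_dev p 0)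

theorem dist_fst_le (p q : Triple) : dist p.1 q.1 ≤ dist p q := by
  rw [Prod.dist_eq (x := p)]; exact le_max_left _ _

theorem dist_snd_le (p q : Triple) : dist p.2.1 q.2.1 ≤ dist p q := by
  rw [Prod.dist_eq (x := p), Prod.dist_eq (x := p.2)]
  exact (le_max_left _ _).trans (le_max_right _ _)

theorem dist_thd_le (p q : Triple) : dist p.2.2 q.2.2 ≤ dist p q := by
  rw [Prod.dist_eq (x := p), Prod.dist_eq (x := p.2)]
  exact (le_max_right _ _).trans (le_max_right _ _)

/-- Each relation compares words whose total length is at most `4`, and multiplication is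
`1`-Lipschitz in each factor. -/
theorem dev_le_of_mem_exactReps {p q : Triple} (hp : p ∈ exactReps) : dev q ≤ 4 * dist p q := by
  obtain ⟨h1, h2, h3⟩ := hp
  have d1 := dist_fst_le p q
  have d2 := dist_snd_le p q
  have d3 := dist_thd_le p q
  have hbi : p.2.1⁻¹ = p.2.1 := inv_eq_of_mul_eq_one_right h2
  have h4 : p.1 * p.2.1 * (p.1 * p.2.1) = 1 := by
    rw [hbi] at h3
    calc p.1 * p.2.1 * (p.1 * p.2.1) = p.1 * (p.2.1 * p.1 * p.2.1) := by group
      _ = 1 := by rw [h3, mul_inv_cancel]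
  have e1 := dist_mul_mul_le_UInf p.1 p.2.2 q.1 q.2.2
  have e2 := dist_mul_mul_le_UInf p.2.2 p.1 q.2.2 q.1
  have e3 := dist_mul_mul_le_UInf p.2.1 p.2.1 q.2.1 q.2.1
  have e4 := dist_mul_mul_le_UInf p.1 p.2.1 q.1 q.2.1
  have e5 := dist_mul_mul_le_UInf (p.1 * p.2.1) (p.1 * p.2.1) (q.1 * q.2.1) (q.1 * q.2.1)
  have hd : 0 ≤ dist p q := dist_nonneg
  refine ciSup_le fun j => ?_
  fin_cases j
  · refine (dist_rel_zero q).trans_le ?_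
    have := dist_triangle_left (q.1 * q.2.2) (q.2.2 * q.1) (p.1 * p.2.2)
    have e6 : dist (p.1 * p.2.2) (q.2.2 * q.1) = dist (p.2.2 * p.1) (q.2.2 * q.1) := by rw [h1.eq]
    linarith
  · refine (dist_rel_one q).trans_le ?_
    rw [h2, dist_comm] at e3
    linarith
  · refine (dist_rel_two q).trans_le ?_
    rw [h4, dist_comm] at e5
    linarith

/-- Homotopy in the class of asymptotic representations, for paths of triples. -/
def TripleHomotopic (x y : C(ℝ≥0, Triple)) : Prop :=
  ∃ H : x.Homotopy y, ∀ ε > 0, ∀ᶠ t in atTop, ∀ s : unitInterval, dev (H (s, t)) < ε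

theorem TripleHomotopic.trans {x y z : C(ℝ≥0, Triple)} (h : TripleHomotopic x y)
    (h' : TripleHomotopic y z) : TripleHomotopic x z := by
  obtain ⟨F, hF⟩ := h
  obtain ⟨G, hG⟩ := h'
  refine ⟨F.trans G, fun ε hε => ?_⟩
  filter_upwards [hF ε hε, hG ε hε] with t h1 h2 s
  rw [ContinuousMap.Homotopy.trans_apply]
  split_ifs
  · exact h1 _
  · exact h2 _

theorem TripleHomotopic.of_continuous {x y : C(ℝ≥0, Triple)} {H : unitInterval × ℝ≥0 → Triple}
    (hH : Continuous H) (h0 : ∀ t, H (0, t) = x t) (h1 : ∀ t, H (1, t) = y t)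
    (hd : ∀ ε > 0, ∀ᶠ t in atTop, ∀ s : unitInterval, dev (H (s, t)) < ε) :
    TripleHomotopic x y :=
  ⟨⟨⟨H, hH⟩, h0, h1⟩, hd⟩

theorem TripleHomotopic.asymHomotopic {σ ρ : ℝ≥0 → Gen → UInf} {x y : C(ℝ≥0, Triple)}
    (h : TripleHomotopic x y) (hx : ∀ t, ofTriple (x t) = σ t) (hy : ∀ t, ofTriple (y t) = ρ t) :
    AsymHomotopic relΓ σ ρ := by
  obtain ⟨H, hH⟩ := h
  have hc : ∀ i, Continuous fun p : unitInterval × ℝ≥0 => ofTriple (H (p.1, p.2)) i := by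
    intro i
    have := H.continuous
    cases i
    · exact this.fst
    · exact this.snd.fst
    · exact this.snd.snd
  refine ⟨fun s t => ofTriple (H (s, t)), hc, fun s => ⟨fun i => ?_, ?_⟩, ?_, ?_, ?_⟩
  · exact (hc i).comp (continuous_const.prodMk continuous_id)
  · rw [Metric.tendsto_atTop']
    intro ε hε
    obtain ⟨T, hT⟩ := eventually_atTop.mp (hH ε hε)
    refine ⟨T, fun t ht => ?_⟩
    rw [Real.dist_eq, sub_zero]
    exact (abs_of_nonneg (dev_nonneg (H (s, t)))).trans_lt (hT t ht.le s)
  · rw [Metric.tendstoUniformly_iff]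
    intro ε hε
    filter_upwards [hH ε hε] with t ht s
    rw [dist_comm, Real.dist_eq, sub_zero]
    exact (abs_of_nonneg (dev_nonneg (H (s, t)))).trans_lt (ht s)
  · funext t; simp only [H.apply_zero]; exact hx t
  · funext t; simp only [H.apply_one]; exact hy t

theorem TripleHomotopic.shift {x y : C(ℝ≥0, Triple)}
    (hx : ∀ ε > 0, ∀ᶠ t in atTop, dev (x t) < ε) (T : ℝ≥0) (hy : ∀ t, y t = x (t + T)) :
    TripleHomotopic x y := by
  refine TripleHomotopic.of_continuous
    (H := fun p => x (p.2 + unitInterval.toNNReal p.1 * T)) (by fun_prop) (by simp)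
    (fun t => by simp [hy]) fun ε hε => ?_
  obtain ⟨T', hT⟩ := eventually_atTop.mp (hx ε hε)
  exact eventually_atTop.mpr ⟨T', fun t ht s => hT _ (ht.trans le_self_add)⟩

/-! ### Interpolation between nearby paths, and homotopies through exact representations. -/

/-- The Cayley path from `u` to `v`. -/
noncomputable def interp (s : unitInterval) (u v : UInf) : UInf := u * cayU s (u⁻¹ * v)

theorem dist_inv_mul_one (u v : UInf) : dist (u⁻¹ * v) 1 = dist v u := by
  simpa using dist_mul_left_UInf u⁻¹ v u

theorem interp_zero {u v : UInf} (h : dist v u < 2) : interp 0 u v = u := by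
  rw [interp, cayU_zero (by rwa [dist_inv_mul_one]), mul_one]

theorem interp_one {u v : UInf} (h : dist v u < 2) : interp 1 u v = v := by
  rw [interp, cayU_one (by rwa [dist_inv_mul_one]), mul_inv_cancel_left]

theorem dist_interp_le {u v : UInf} (h : dist v u ≤ 1) (s : unitInterval) :
    dist (interp s u v) u ≤ 2 * dist v u := by
  have h1 := dist_mul_left_UInf u (cayU s (u⁻¹ * v)) 1
  rw [mul_one] at h1
  have h2 := dist_cayU_one_le (w := u⁻¹ * v) (by rwa [dist_inv_mul_one]) s
  rw [dist_inv_mul_one] at h2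
  exact h1.trans_le h2

theorem continuous_interp {Y : Type*} [TopologicalSpace Y] {s : Y → unitInterval} {u v : Y → UInf}
    (hs : Continuous s) (hu : Continuous u) (hv : Continuous v) (h : ∀ y, dist (v y) (u y) < 2) :
    Continuous fun y => interp (s y) (u y) (v y) :=
  hu.mul (continuous_cayU hs (hu.inv.mul hv) fun y => by rw [dist_inv_mul_one]; exact h y)

/-- The componentwise Cayley path between triples. -/
noncomputable def interpT (s : unitInterval) (p q : Triple) : Triple :=
  (interp s p.1 q.1, interp s p.2.1 q.2.1, interp s p.2.2 q.2.2)

theorem interpT_zero {p q : Triple} (h : dist q p < 2) : interpT 0 p q = p := by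
  rw [interpT, interp_zero ((dist_fst_le q p).trans_lt h),
    interp_zero ((dist_snd_le q p).trans_lt h), interp_zero ((dist_thd_le q p).trans_lt h)]

theorem interpT_one {p q : Triple} (h : dist q p < 2) : interpT 1 p q = q := by
  rw [interpT, interp_one ((dist_fst_le q p).trans_lt h),
    interp_one ((dist_snd_le q p).trans_lt h), interp_one ((dist_thd_le q p).trans_lt h)]

theorem dist_interpT_le {p q : Triple} (h : dist q p ≤ 1) (s : unitInterval) :
    dist (interpT s p q) p ≤ 2 * dist q p := by
  have h1 := dist_fst_le q p
  have h2 := dist_snd_le q p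
  have h3 := dist_thd_le q p
  exact dist_triple_le ((dist_interp_le (h1.trans h) s).trans (by linarith))
    ((dist_interp_le (h2.trans h) s).trans (by linarith))
    ((dist_interp_le (h3.trans h) s).trans (by linarith))

theorem TripleHomotopic.of_dist_le {x y : C(ℝ≥0, Triple)} (hy : ∀ t, y t ∈ exactReps)
    (h1 : ∀ t, dist (y t) (x t) ≤ 1)
    (hd : Tendsto (fun t => dist (y t) (x t)) atTop (𝓝 0)) : TripleHomotopic x y := by
  have h2 : ∀ t, dist (y t) (x t) < 2 := fun t => (h1 t).trans_lt one_lt_two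
  have hx := x.continuous
  have hy' := y.continuous
  have hc : Continuous fun p : unitInterval × ℝ≥0 => interpT p.1 (x p.2) (y p.2) := by
    refine Continuous.prodMk ?_ (Continuous.prodMk ?_ ?_)
    · exact continuous_interp continuous_fst (hx.comp continuous_snd).fst
        (hy'.comp continuous_snd).fst fun p => (dist_fst_le _ _).trans_lt (h2 _)
    · exact continuous_interp continuous_fst (hx.comp continuous_snd).snd.fst
        (hy'.comp continuous_snd).snd.fst fun p => (dist_snd_le _ _).trans_lt (h2 _)
    · exact continuous_interp continuous_fst (hx.comp continuous_snd).snd.snd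
        (hy'.comp continuous_snd).snd.snd fun p => (dist_thd_le _ _).trans_lt (h2 _)
  refine TripleHomotopic.of_continuous hc (fun t => interpT_zero (h2 t))
    (fun t => interpT_one (h2 t)) fun ε hε => ?_
  -- The interpolation is within `2 + 1` times `dist (y t) (x t)` of the exact point `y t`, and the
  -- deviation is `4`-Lipschitz there; hence `12`.
  filter_upwards [hd.eventually (gt_mem_nhds (by positivity : 0 < ε / 12))] with t ht s
  refine (dev_le_of_mem_exactReps (hy t)).trans_lt ?_
  have e1 := dist_interpT_le (h1 t) s
  have e2 := dist_triangle_right (y t) (interpT s (x t) (y t)) (x t)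
  linarith

theorem dev_lt_of_mem_exactReps {p : Triple} (hp : p ∈ exactReps) {ε : ℝ} (hε : 0 < ε) :
    dev p < ε :=
  (dev_le_of_mem_exactReps hp).trans_lt (by simpa using hε)

/-- The homotopy runs time backwards, `x ((1 - s) t)`. It is admissible because the deviation
vanishes at every time, not only asymptotically. -/
theorem TripleHomotopic.const_of_mem {x : C(ℝ≥0, Triple)} (hx : ∀ t, x t ∈ exactReps) :
    TripleHomotopic x (ContinuousMap.const _ (x 0)) :=
  TripleHomotopic.of_continuous
    (H := fun p => x (unitInterval.toNNReal (unitInterval.symm p.1) * p.2)) (by fun_prop) (by simp)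
    (by simp) fun _ hε => Eventually.of_forall fun _ _ => dev_lt_of_mem_exactReps (hx _) hε

theorem TripleHomotopic.const_of_joinedIn {p q : Triple} (h : JoinedIn exactReps p q) :
    TripleHomotopic (ContinuousMap.const _ p) (ContinuousMap.const _ q) :=
  TripleHomotopic.of_continuous (H := fun r => h.somePath r.1) (by fun_prop) (by simp) (by simp)
    fun _ hε => Eventually.of_forall fun _ _ => dev_lt_of_mem_exactReps (h.somePath_mem _) hε

/-! ### Contracting the third generator, and the rank bound. -/

/-- Square roots in `U_∞`. -/
theorem exists_sqrt (c : UInf) :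
    ∃ d : UInf, d * d = c ∧ dist d 1 < 2 ∧ ∀ a, Commute a c → Commute a d := by
  -- Halving the argument is discontinuous at `-1`, which is harmless on a finite spectrum.
  set f : ℂ → ℂ := fun z => Complex.exp (Complex.I * (z.arg / 2 : ℝ)) with hf
  have hn := isStarNormal_opU c
  have hcont : ContinuousOn f (spectrum ℂ (opU c)) :=
    (spectrum_finite_and_ncard_le c).1.continuousOn f
  have hun : cfc f (opU c) ∈ unitary (Hil →L[ℂ] Hil) := by
    rw [cfc_unitary_iff f (opU c)]
    intro z _
    rw [Complex.star_def, mul_comm, Complex.mul_conj, Complex.normSq_eq_norm_sq,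
      Complex.norm_exp_I_mul_ofReal]
    simp
  refine ⟨mkU _ hun (fixes_cfc c (by simp [hf])), opU_injective ?_, ?_, fun a ha =>
    opU_injective ?_⟩
  · rw [opU_mul, opU_mkU, ← cfc_mul f f (opU c)]
    conv_rhs => rw [← cfc_id' ℂ (opU c)]
    refine cfc_congr fun z hz => ?_
    have h1 := Complex.norm_mul_exp_arg_mul_I z
    rw [norm_eq_one_of_mem_spectrum hz] at h1
    simp only [hf]
    rw [← Complex.exp_add]
    conv_rhs => rw [← h1]
    rw [Complex.ofReal_one, one_mul]
    congr 1; push_cast; ring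
  · rw [dist_one_eq, opU_mkU]
    have h1 : cfc f (opU c) - 1 = cfc (fun z => f z - 1) (opU c) := by
      rw [cfc_sub f (fun _ => 1) (opU c), cfc_const_one ℂ (opU c)]
    rw [h1]
    -- The arguments of the root are at most `π / 2 < 2` in absolute value, so the Cayley path
    -- applies to it.
    refine lt_of_le_of_lt (norm_cfc_le (c := Real.pi / 2) (by positivity) fun z _ => ?_)
      (by linarith [Real.pi_lt_four])
    refine (Real.norm_exp_I_mul_ofReal_sub_one_le).trans ?_
    rw [Real.norm_eq_abs, abs_div, abs_two]
    linarith [Complex.abs_arg_le_pi z]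
  · rw [opU_mul, opU_mul, opU_mkU]
    have h1 : Commute (opU c) (opU a) := (commute_opU ha).symm
    have h2 : Commute (star (opU c)) (opU a) := (commute_opU ha.inv_right).symm
    exact (Commute.cfc h1 h2 f).eq.symm

/-- Since `c` may have eigenvalue `-1`, the Cayley path is applied to a square root of `c` in the
commutant of `a` and then squared. -/
theorem joinedIn_exactReps_one {a b c : UInf} (hp : (a, b, c) ∈ exactReps) :
    JoinedIn exactReps (a, b, c) (a, b, 1) := by
  obtain ⟨d, hd, hd2, hcom⟩ := exists_sqrt c
  have had := hcom a hp.1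
  have hc : Continuous fun s : unitInterval => cayU s d :=
    continuous_cayU continuous_id continuous_const fun _ => hd2
  refine (joinedIn_of_continuous (f := fun s => (a, b, cayU s d * cayU s d)) (by fun_prop) ?_ ?_
    fun s => ?_).symm
  · simp only [cayU_zero hd2, mul_one]
  · simp only [cayU_one hd2, hd]
  · exact ⟨(commute_cayU had s).mul_right (commute_cayU had s), hp.2.1, hp.2.2⟩

/-- Involutions chosen near `u t` and `u s` with `s` close to `t` are close, hence of equal rank.
The rank is thus locally constant on the connected half-line, whatever the choices. -/
theorem exists_rank_bound {u : ℝ≥0 → UInf} (hu : Continuous u)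
    (h : ∀ ε > 0, ∀ᶠ t in atTop, dist (u t * u t) 1 < ε) :
    ∃ N : ℕ, ∀ᶠ t in atTop, ∀ v : UInf, v * v = 1 → dist v (u t) ≤ 1 / 16 → rk v ≤ N := by
  obtain ⟨T, hT⟩ := eventually_atTop.mp (h (1 / 64) (by norm_num))
  have hex : ∀ t : ℝ≥0, ∃ v : UInf, v * v = 1 ∧ dist v (u (t + T)) ≤ 1 / 32 := fun t => by
    have h1 := hT (t + T) le_add_self
    obtain ⟨v, hv, hd⟩ := exists_involution (u := u (t + T)) (by linarith)
    exact ⟨v, hv, by linarith⟩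
  choose v hv hvd using hex
  have hlc : IsLocallyConstant fun t => rk (v t) := by
    rw [IsLocallyConstant.iff_eventually_eq]
    intro t
    have hc : Continuous fun t => u (t + T) := hu.comp (by fun_prop)
    filter_upwards [Metric.continuous_iff'.mp hc t (1 / 32) (by norm_num)] with s hs
    refine rk_eq_of_involutions (hv s) (hv t) ?_
    have h1 := dist_triangle4 (v s) (u (s + T)) (u (t + T)) (v t)
    rw [dist_comm (u (t + T)) (v t)] at h1
    linarith [hvd s, hvd t]
  refine ⟨rk (v 0), eventually_atTop.mpr ⟨T, fun t ht w hw hd => ?_⟩⟩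
  have h1 := hlc.apply_eq_of_preconnectedSpace (t - T) 0
  have h2 := hvd (t - T)
  rw [tsub_add_cancel_of_le ht] at h2
  rw [← h1]
  refine (rk_eq_of_involutions hw (hv _) ?_).le
  have h3 := dist_triangle w (u t) (v (t - T))
  rw [dist_comm (u t) (v (t - T))] at h3
  linarith

theorem eventually_exactRep_near {x : C(ℝ≥0, Triple)}
    (hx : ∀ ε > 0, ∀ᶠ t in atTop, dev (x t) < ε) :
    ∃ N : ℕ, ∀ ε > 0, ∀ᶠ t in atTop, ∃ p ∈ exactReps, rk p.1 ≤ N ∧ dist p (x t) < ε := by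
  have hb : ∀ ε > 0, ∀ᶠ t in atTop, dist ((x t).2.1 * (x t).2.1) 1 < ε := fun ε hε => by
    filter_upwards [hx ε hε] with t ht
    rw [← dist_rel_one]; exact (norm_rel_le_dev _ 1).trans_lt ht
  have hs : ∀ ε > 0, ∀ᶠ t in atTop,
      dist ((x t).1 * (x t).2.1 * ((x t).1 * (x t).2.1)) 1 < ε := fun ε hε => by
    filter_upwards [hx ε hε] with t ht
    rw [← dist_rel_two]; exact (norm_rel_le_dev _ 2).trans_lt ht
  have hac : ∀ ε > 0, ∀ᶠ t in atTop,
      dist ((x t).1 * (x t).2.2) ((x t).2.2 * (x t).1) < ε := fun ε hε => by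
    filter_upwards [hx ε hε] with t ht
    rw [← dist_rel_zero]; exact (norm_rel_le_dev _ 0).trans_lt ht
  obtain ⟨N₁, h₁⟩ := exists_rank_bound (u := fun t => (x t).2.1) (by fun_prop) hb
  obtain ⟨N₂, h₂⟩ := exists_rank_bound (u := fun t => (x t).1 * (x t).2.1) (by fun_prop) hs
  refine ⟨2 * max N₁ N₂, fun ε hε => ?_⟩
  obtain ⟨δ, hδ, H⟩ := exists_exactRep_near hε (max N₁ N₂)
  filter_upwards [hb δ hδ, hs δ hδ, hac δ hδ, h₁, h₂] with t e1 e2 e3 e4 e5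
  exact H _ _ _ e1 e2 e3 (fun v hv hd => (e4 v hv hd).trans (le_max_left _ _))
    (fun v hv hd => (e5 v hv hd).trans (le_max_right _ _))

/-- An asymptotic representation is homotopic to a constant exact one with trivial third
component. -/
theorem exists_homotopic_const {x : C(ℝ≥0, Triple)}
    (hx : ∀ ε > 0, ∀ᶠ t in atTop, dev (x t) < ε) :
    ∃ a b : UInf, (a, b, (1 : UInf)) ∈ exactReps ∧
      TripleHomotopic x (ContinuousMap.const _ (a, b, 1)) := by
  obtain ⟨N, hN⟩ := eventually_exactRep_near hx
  obtain ⟨T, τ, hτ, hτE, hτd⟩ := exists_asymptotic_path (E := exactReps)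
    (G := {p | p ∈ exactReps ∧ rk p.1 ≤ N}) x.continuous
    (fun ε hε => by
      filter_upwards [hN ε hε] with t ⟨p, hp, hr, hd⟩
      exact ⟨p, ⟨hp, hr⟩, hd⟩)
    (fun ε hε => by
      obtain ⟨δ, hδ, H⟩ := exactReps_locally_joined hε N
      exact ⟨δ, hδ, fun p hp q hq hd => H p hp.1 q hq.1 hp.2 hq.2 hd⟩)
  -- A second shift makes the distance at most `1` at every time, as the interpolation requires.
  obtain ⟨T₁, hT₁⟩ := eventually_atTop.mp (hτd.eventually (gt_mem_nhds one_pos))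
  let y : C(ℝ≥0, Triple) := ⟨fun t => x (t + (T₁ + T)), by fun_prop⟩
  let z : C(ℝ≥0, Triple) := ⟨fun t => τ (t + T₁), by fun_prop⟩
  have h1 : TripleHomotopic x y := TripleHomotopic.shift hx (T₁ + T) fun t => rfl
  have h2 : TripleHomotopic y z := by
    refine TripleHomotopic.of_dist_le (fun t => hτE _) (fun t => ?_) ?_
    · have := hT₁ (t + T₁) le_add_self
      rw [add_assoc] at this
      exact this.le
    · have h5 : Tendsto (fun t : ℝ≥0 => t + T₁) atTop atTop :=
        tendsto_atTop_mono (fun t => le_self_add) tendsto_id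
      have h6 := hτd.comp h5
      have h7 : (fun t => dist (z t) (y t)) =
          (fun t => dist (τ t) (x (t + T))) ∘ fun t : ℝ≥0 => t + T₁ := by
        funext t
        change dist (τ (t + T₁)) (x (t + (T₁ + T))) = dist (τ (t + T₁)) (x (t + T₁ + T))
        rw [add_assoc]
      rw [h7]; exact h6
  have h3 := TripleHomotopic.const_of_mem (x := z) fun t => hτE _
  have h4 := joinedIn_exactReps_one (hτE (0 + T₁))
  exact ⟨_, _, h4.target_mem, h1.trans (h2.trans (h3.trans (TripleHomotopic.const_of_joinedIn h4)))⟩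


/-! ### The winding number -/

theorem eq_of_exp_eq {f g : ℝ → ℂ} (hf : Continuous f) (hg : Continuous g)
    (h : ∀ x, Complex.exp (f x) = Complex.exp (g x)) (h0 : f 0 = g 0) : f = g :=
  Complex.isCoveringMap_exp.eq_of_comp_eq hf hg (funext fun x => Subtype.ext (h x)) 0 h0

/-- The plane is simply connected, so the map lifts through the covering `exp`. -/
theorem exists_log {Γ : ℝ × ℝ → ℂ} (hΓ : Continuous Γ) (h0 : ∀ p, Γ p ≠ 0) :
    ∃ L : ℝ × ℝ → ℂ, Continuous L ∧ ∀ p, Complex.exp (L p) = Γ p := by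
  obtain ⟨z, hz⟩ : ∃ z, Complex.exp z = Γ 0 := ⟨_, Complex.exp_log (h0 0)⟩
  obtain ⟨F, ⟨-, hF⟩, -⟩ := Complex.isCoveringMap_exp.existsUnique_continuousMap_lifts
    (⟨fun p => ⟨Γ p, h0 p⟩, by fun_prop⟩ : C(ℝ × ℝ, {z : ℂ // z ≠ 0})) 0 z (Subtype.ext hz)
  exact ⟨F, F.continuous, fun p => congrArg Subtype.val (congrFun hF p)⟩

/-- A loop which is joined to a constant one through loops in `ℂ \ {0}` has winding number zero. -/
theorem isWindingNumber_zero {Γ : ℝ × ℝ → ℂ} (hΓ : Continuous Γ) (h0 : ∀ p, Γ p ≠ 0)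
    (hloop : ∀ s, Γ (s, 0) = Γ (s, 1)) (hconst : ∀ r, Γ (0, r) = Γ (0, 0)) :
    IsWindingNumber (fun r => Γ (1, (r : ℝ))) 0 := by
  obtain ⟨L, hL, hexp⟩ := exists_log hΓ h0
  have h1 : (fun r => L (0, r)) = fun _ => L (0, 0) :=
    eq_of_exp_eq (by fun_prop) continuous_const (fun r => by rw [hexp, hexp, hconst]) rfl
  -- The increment of the logarithm is continuous in `s`, exponentiates to `1` and vanishes at `s =
  -- 0`, hence everywhere.
  have h2 : (fun s => L (s, 1) - L (s, 0)) = fun _ => 0 := by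
    refine eq_of_exp_eq (by fun_prop) continuous_const (fun s => ?_) ?_
    · rw [Complex.exp_sub, hexp, hexp, hloop, div_self (h0 _), Complex.exp_zero]
    · rw [congrFun h1 1, sub_self]
  refine ⟨fun r => L (1, (r : ℝ)), by fun_prop, fun r => hexp _, ?_⟩
  have := congrFun h2 1
  simpa using this

/-- The operators preserving the span of the first `n` basis vectors. -/
def PreservesLevel (n : ℕ) (x : Hil →L[ℂ] Hil) : Prop :=
  ∀ ξ : Hil, (∀ k, n ≤ k → ξ k = 0) → ∀ k, n ≤ k → x ξ k = 0

theorem PreservesLevel.mul {n : ℕ} {x y : Hil →L[ℂ] Hil} (hx : PreservesLevel n x)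
    (hy : PreservesLevel n y) : PreservesLevel n (x * y) := fun ξ hξ => hx _ (hy ξ hξ)

theorem PreservesLevel.add_smul {n : ℕ} {x y : Hil →L[ℂ] Hil} (hx : PreservesLevel n x)
    (hy : PreservesLevel n y) (α β : ℂ) : PreservesLevel n (α • x + β • y) := fun ξ hξ k hk => by
  change α * x ξ k + β * y ξ k = 0
  rw [hx ξ hξ k hk, hy ξ hξ k hk, mul_zero, mul_zero, add_zero]

theorem preservesLevel_opU {n : ℕ} {u : UInf} (hu : (u : unitary (Hil →L[ℂ] Hil)) ∈ levelU n) :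
    PreservesLevel n (opU u) := fun ξ hξ k hk => by
  rw [levelU_apply_coord hu ξ hk, hξ k hk]

/-- The vectors `x e_j` with `j < n` stay in the span of the first `n` basis vectors, so truncating
between the factors loses nothing; the left factor may be arbitrary. -/
theorem corner_mul {n : ℕ} (z : Hil →L[ℂ] Hil) {x : Hil →L[ℂ] Hil} (hx : PreservesLevel n x) :
    corner n (z * x) = corner n z * corner n x := by
  ext i j
  have h : ∀ k, n ≤ k → x (basisVec j) k = 0 := hx _ fun k hk =>
    basisVec_apply_ne (by have := j.2; omega)
  change z (x (basisVec j)) (i : ℕ) = _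
  rw [eq_sum_basisVec h, map_sum, lp.coeFn_sum, Finset.sum_apply, Matrix.mul_apply]
  refine Finset.sum_congr rfl fun k _ => ?_
  simp [corner, mul_comm]

theorem corner_one (n : ℕ) : corner n 1 = 1 := by
  ext i j
  change (basisVec j : ℕ → ℂ) i = _
  rcases eq_or_ne i j with h | h
  · rw [h, basisVec_apply_self, Matrix.one_apply_eq]
  · rw [basisVec_apply_ne (fun h' => h (Fin.ext h')), Matrix.one_apply_ne h]

theorem det_corner_ne_zero {n : ℕ} {x : Hil →L[ℂ] Hil} (hx : PreservesLevel n x) (hu : IsUnit x) :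
    (corner n x).det ≠ 0 := by
  have h := corner_mul (Ring.inverse x) hx
  rw [Ring.inverse_mul_cancel _ hu, corner_one] at h
  have h2 := congrArg Matrix.det h
  rw [Matrix.det_one, Matrix.det_mul] at h2
  exact right_ne_zero_of_mul (h2 ▸ one_ne_zero)

theorem continuous_corner (n : ℕ) : Continuous (corner n) := by
  refine continuous_matrix fun i j => ?_
  have : (fun x : Hil →L[ℂ] Hil => corner n x i j) =
      fun x => inner ℂ (basisVec i) (x (basisVec j)) := by
    funext x; rw [inner_basisVec]; rfl
  rw [this]
  fun_prop

theorem norm_segment_sub_le {E : Type*} [NormedAddCommGroup E] [NormedSpace ℂ E] {x y z : E}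
    {r : ℝ} (hx : ‖x - z‖ ≤ r) (hy : ‖y - z‖ ≤ r) {s : ℝ} (hs : s ∈ Set.Icc (0 : ℝ) 1) :
    ‖((1 - (s : ℂ)) • x + (s : ℂ) • y) - z‖ ≤ r := by
  have h : ((1 - (s : ℂ)) • x + (s : ℂ) • y) - z = (1 - (s : ℂ)) • (x - z) + (s : ℂ) • (y - z) := by
    module
  rw [h]
  refine (norm_add_le _ _).trans ?_
  have h1 : ‖(1 - (s : ℂ))‖ = 1 - s := by
    rw [← Complex.ofReal_one, ← Complex.ofReal_sub, Complex.norm_real,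
      Real.norm_of_nonneg (by linarith [hs.2])]
  rw [norm_smul, norm_smul, h1, Complex.norm_real, Real.norm_of_nonneg hs.1]
  nlinarith [hs.1, hs.2]

theorem norm_mul_sub_mul_opU_le {x y : Hil →L[ℂ] Hil} {u v : UInf} {r : ℝ} (hx : ‖x - opU u‖ ≤ r)
    (hy : ‖y - opU v‖ ≤ r) (hr : r ≤ 1) : ‖x * y - opU u * opU v‖ ≤ 3 * r := by
  have h : x * y - opU u * opU v =
      (x - opU u) * (y - opU v) + ((x - opU u) * opU v + opU u * (y - opU v)) := by
    noncomm_ring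
  have h1 : ‖(x - opU u) * (y - opU v)‖ ≤ r * 1 :=
    (norm_mul_le _ _).trans (mul_le_mul hx (hy.trans hr) (norm_nonneg _)
      ((norm_nonneg _).trans hx))
  rw [h]
  refine (norm_add_le _ _).trans ?_
  have h2 := norm_add_le ((x - opU u) * opU v) (opU u * (y - opU v))
  rw [norm_mul_opU, norm_opU_mul] at h2
  linarith

/-- The straight segment between two operators, stopped at its ends. -/
noncomputable def segment (x y : Hil →L[ℂ] Hil) (s : ℝ) : Hil →L[ℂ] Hil :=
  (1 - ((Set.projIcc (0 : ℝ) 1 zero_le_one s : ℝ) : ℂ)) • x +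
    ((Set.projIcc (0 : ℝ) 1 zero_le_one s : ℝ) : ℂ) • y

theorem continuous_segment {Y : Type*} [TopologicalSpace Y] {x y : Y → Hil →L[ℂ] Hil} {s : Y → ℝ}
    (hx : Continuous x) (hy : Continuous y) (hs : Continuous s) :
    Continuous fun p => segment (x p) (y p) (s p) := by
  have h : Continuous fun p => ((Set.projIcc (0 : ℝ) 1 zero_le_one (s p) : ℝ) : ℂ) :=
    Complex.continuous_ofReal.comp (continuous_subtype_val.comp (continuous_projIcc.comp hs))
  exact ((continuous_const.sub h).smul hx).add (h.smul hy)

theorem segment_zero (x y : Hil →L[ℂ] Hil) : segment x y 0 = x := by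
  simp [segment]

theorem segment_one (x y : Hil →L[ℂ] Hil) : segment x y 1 = y := by
  simp [segment]

theorem segment_self (x : Hil →L[ℂ] Hil) (s : ℝ) : segment x x s = x := by
  rw [segment, ← add_smul]; simp

/-- Straight segments from `(a₀, c₀)` to `(a, c)` leave the unitaries, but every operator in the
family is within `7 / 100 = 3 / 100 + 4 / 100` of the unitary `ac`, hence invertible. The
determinants deform the loop of `(a, c)` to the constant loop of the commuting pair. -/
theorem hasPairWindingNumber_zero {a c a₀ c₀ : UInf} (h0 : Commute a₀ c₀)
    (ha : dist a₀ a ≤ 1 / 100) (hc : dist c₀ c ≤ 1 / 100) : HasPairWindingNumber a c 0 := by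
  have hcomm : dist (a * c) (c * a) ≤ 4 / 100 := by
    have e1 := dist_mul_mul_le_UInf a₀ c₀ a c
    have e2 := dist_mul_mul_le_UInf c₀ a₀ c a
    rw [← h0.eq] at e2
    linarith [dist_triangle_left (a * c) (c * a) (a₀ * c₀)]
  rw [dist_eq_norm_opU, opU_mul, opU_mul] at hcomm
  refine ⟨by linarith, ?_⟩
  obtain ⟨n₁, h₁⟩ := a.2
  obtain ⟨n₂, h₂⟩ := c.2
  obtain ⟨n₃, h₃⟩ := a₀.2
  obtain ⟨n₄, h₄⟩ := c₀.2
  obtain ⟨n, hn⟩ : ∃ n, n₁ ≤ n ∧ n₂ ≤ n ∧ n₃ ≤ n ∧ n₄ ≤ n :=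
    ⟨max (max n₁ n₂) (max n₃ n₄), by omega⟩
  have l1 := levelU_mono hn.1 h₁
  have l2 := levelU_mono hn.2.1 h₂
  have l3 := levelU_mono hn.2.2.1 h₃
  have l4 := levelU_mono hn.2.2.2 h₄
  refine ⟨n, l1, l2, ?_⟩
  let A : ℝ → Hil →L[ℂ] Hil := segment (opU a₀) (opU a)
  let C : ℝ → Hil →L[ℂ] Hil := segment (opU c₀) (opU c)
  have hA : ∀ s, ‖A s - opU a‖ ≤ 1 / 100 := fun s =>
    norm_segment_sub_le (by rwa [← dist_eq_norm_opU]) (by simp) (Set.projIcc _ _ _ s).2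
  have hC : ∀ s, ‖C s - opU c‖ ≤ 1 / 100 := fun s =>
    norm_segment_sub_le (by rwa [← dist_eq_norm_opU]) (by simp) (Set.projIcc _ _ _ s).2
  have pA : ∀ s, PreservesLevel n (A s) := fun s =>
    (preservesLevel_opU l3).add_smul (preservesLevel_opU l1) _ _
  have pC : ∀ s, PreservesLevel n (C s) := fun s =>
    (preservesLevel_opU l4).add_smul (preservesLevel_opU l2) _ _
  let X : ℝ × ℝ → Hil →L[ℂ] Hil := fun p => segment (A p.1 * C p.1) (C p.1 * A p.1) p.2
  have cA : Continuous A := continuous_segment continuous_const continuous_const continuous_id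
  have cC : Continuous C := continuous_segment continuous_const continuous_const continuous_id
  have cX : Continuous X :=
    continuous_segment ((cA.comp continuous_fst).mul (cC.comp continuous_fst))
      ((cC.comp continuous_fst).mul (cA.comp continuous_fst)) continuous_snd
  have pX : ∀ p, PreservesLevel n (X p) := fun p =>
    ((pA _).mul (pC _)).add_smul ((pC _).mul (pA _)) _ _
  have uX : ∀ p, IsUnit (X p) := fun p => by
    have e1 := norm_mul_sub_mul_opU_le (hA p.1) (hC p.1) (by norm_num)
    have e2 := norm_mul_sub_mul_opU_le (hC p.1) (hA p.1) (by norm_num)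
    have e3 : ‖C p.1 * A p.1 - opU a * opU c‖ ≤ 7 / 100 := by
      have := norm_sub_le_norm_sub_add_norm_sub (C p.1 * A p.1) (opU c * opU a) (opU a * opU c)
      rw [norm_sub_rev (opU c * opU a)] at this
      linarith
    have e4 : ‖X p - opU a * opU c‖ ≤ 7 / 100 :=
      norm_segment_sub_le (by linarith) e3 (Set.projIcc _ _ _ p.2).2
    exact isUnit_of_norm_sub_unitary_lt (opU_mem_unitary (a * c)) (e4.trans_lt (by norm_num))
  have key := isWindingNumber_zero (Γ := fun p => (corner n (X p)).det)
    (((continuous_corner n).comp cX).matrix_det) (fun p => det_corner_ne_zero (pX p) (uX p))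
    (fun s => by
      -- Each intermediate loop closes because `det (AC) = det (CA)`, although `A` and `C` need not
      -- commute.
      simp only [X, segment_zero, segment_one]
      rw [corner_mul _ (pC s), corner_mul _ (pA s), Matrix.det_mul, Matrix.det_mul, mul_comm])
    (fun r => by
      have : C 0 * A 0 = A 0 * C 0 := by
        simp only [A, C, segment_zero]; exact (commute_opU h0).eq.symm
      simp only [X, this, segment_self])
  have hX : ∀ r : unitInterval, X (1, (r : ℝ)) =
      (1 - ((r : ℝ) : ℂ)) • (opU a * opU c) + ((r : ℝ) : ℂ) • (opU c * opU a) := fun r => by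
    simp only [X, A, C, segment_one]
    rw [segment, Set.projIcc_val]
  simpa only [hX] using key

end AsymRep

theorem mainTheorem3 (σ : ℝ≥0 → AsymRep.Gen → AsymRep.UInf)
    (hσ : AsymRep.IsAsymptoticRep AsymRep.relΓ σ) :
    (∀ᶠ t in atTop, AsymRep.HasPairWindingNumber (σ t AsymRep.Gen.a) (σ t AsymRep.Gen.c) 0) ∧
    ∃ ρ : ℝ≥0 → AsymRep.Gen → AsymRep.UInf,
      AsymRep.IsAsymptoticRep AsymRep.relΓ ρ ∧
      (∀ t, ρ t AsymRep.Gen.c = 1) ∧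
      AsymRep.AsymHomotopic AsymRep.relΓ σ ρ := by
  let x : C(ℝ≥0, AsymRep.Triple) := ⟨fun t => AsymRep.toTriple (σ t),
    (hσ.continuous_path _).prodMk ((hσ.continuous_path _).prodMk (hσ.continuous_path _))⟩
  have hxσ : ∀ t, AsymRep.ofTriple (x t) = σ t := fun t => AsymRep.ofTriple_toTriple (σ t)
  have hx : ∀ ε > 0, ∀ᶠ t in atTop, AsymRep.dev (x t) < ε := fun ε hε => by
    filter_upwards [hσ.tendsto_deviation.eventually (gt_mem_nhds hε)] with t ht
    rwa [AsymRep.dev, hxσ]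
  refine ⟨?_, ?_⟩
  · obtain ⟨N, hN⟩ := AsymRep.eventually_exactRep_near hx
    filter_upwards [hN (1 / 100) (by norm_num)] with t ht
    obtain ⟨p, hp, -, hd⟩ := ht
    exact AsymRep.hasPairWindingNumber_zero hp.1 ((AsymRep.dist_fst_le p (x t)).trans hd.le)
      ((AsymRep.dist_thd_le p (x t)).trans hd.le)
  · obtain ⟨a, b, -, hab⟩ := AsymRep.exists_homotopic_const hx
    have hhom := hab.asymHomotopic (ρ := fun _ => AsymRep.ofTriple (a, b, 1)) hxσ fun t => rfl
    refine ⟨_, ?_, fun t => rfl, hhom⟩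
    -- The end `F 1` of the homotopy is itself an asymptotic representation.
    obtain ⟨F, -, hF, -, -, h1⟩ := hhom
    rw [← h1]
    exact hF 1
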